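/- Let $N\ge 1$ be an integer, let $\beta>0$ and $M>N-1$ be real numbers, and let $(\lambda_1,\dots,\lambda_N)$ be distributed as the $\beta$-Laguerre ensemble, that is, with joint probability density $$\frac{1}{Z_{N,M}^{(\beta)}}\prod_{i<j}|\lambda_j-\lambda_i|^{\beta}\prod_{i=1}^N\Big(\lambda_i^{\frac{\beta}{2}(M-N+1)-1}e^{-\frac{\beta M}{2}\lambda_i}\Big),\qquad \lambda_1,\dots,\lambda_N>0,$$ where $0<Z_{N,M}^{(\beta)}<\infty$ is the normalizing constant. Let $L_N=\frac1N\sum_{i=1}^N\delta_{\lambda_i}$ be the empirical distribution and write $\langle L_N,g\rangle=\int g\,dL_N=\frac1N\sum_{i=1}^N g(\lambda_i)$. Then for every continuously differentiable function $f:\mathbb R\to\mathbb R$, $$\operatorname{Var}\big[\langle L_N,f\rangle\big]\le\frac{4}{\beta MN}\,\mathbb E\big[\langle L_N,\,x f'(x)^2\rangle\big],$$ as an inequality in $[0,\infty]$; in particular, if the right-hand side is finite, then $\langle L_N,f\rangle$ is square integrable. (The variance is taken to be $+\infty$ when $\langle L_N,f\rangle$ is not square integrable.) -/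

import Mathlib

open scoped ENNReal

/-- The unnormalized joint density of the beta Laguerre ensemble,
`∏_{i<j} |x_j - x_i|^β * ∏_i x_i^(β/2 (M-N+1) - 1) e^(-β M x_i / 2)` (for positive `x_i`). -/
noncomputable def laguerreWeight (N : ℕ) (M β : ℝ) (x : Fin N → ℝ) : ℝ :=
  (∏ i : Fin N, ∏ j ∈ Finset.Ioi i, |x j - x i| ^ β) *
    ∏ i : Fin N, (x i ^ (β / 2 * (M - N + 1) - 1) * Real.exp (-(β * M / 2) * x i))

/-- The unnormalized law: `laguerreWeight` times Lebesgue measure on the positive orthant. -/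
noncomputable def laguerreUnnormalized (N : ℕ) (M β : ℝ) : MeasureTheory.Measure (Fin N → ℝ) :=
  (MeasureTheory.volume.restrict {x : Fin N → ℝ | ∀ i, 0 < x i}).withDensity
    (fun x => ENNReal.ofReal (laguerreWeight N M β x))

/-- The normalizing constant: the total mass of the unnormalized law. -/
noncomputable def laguerreZ (N : ℕ) (M β : ℝ) : ℝ≥0∞ :=
  laguerreUnnormalized N M β Set.univ

/-- The law of the particles `(λ_1, …, λ_N)` of the beta Laguerre ensemble. -/
noncomputable def betaLaguerre (N : ℕ) (M β : ℝ) : MeasureTheory.Measure (Fin N → ℝ) :=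
  (laguerreZ N M β)⁻¹ • laguerreUnnormalized N M β

/-- The empirical distribution `L_N = N⁻¹ ∑_i δ_{x_i}` of a configuration of `N` particles. -/
noncomputable def empiricalLaw {N : ℕ} (x : Fin N → ℝ) : MeasureTheory.Measure ℝ :=
  (N : ℝ≥0∞)⁻¹ • ∑ i : Fin N, MeasureTheory.Measure.dirac (x i)

/-!
The inequality is a spectral gap. The ensemble is reversible for the Laguerre diffusion with
generator `L = ∑ x_i ∂_i² + ∑ (a - b x_i) ∂_i + β ∑_{i<j} (x_i ∂_i - x_j ∂_j) / (x_i - x_j)`,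
where `a = β (M - N + 1) / 2` and `b = β M / 2`, and whose Dirichlet form is `E ∑ x_i (∂_i p)²`.

On a symmetric polynomial `x_i ∂_i p - x_j ∂_j p` is antisymmetric under the exchange of `x_i` and
`x_j`, hence divisible by `x_i - x_j`. So `L` maps symmetric polynomials to symmetric polynomials,
and it multiplies those of degree `k` by `-b k` modulo lower degree (`generator_add_mem`). Since
`L` is self-adjoint (`integral_mul_laguerreGenerator`), it is diagonal with eigenvalue `-b k` on
the orthogonal complement of degree `k - 1` in degree `k`. This gives `b Var p ≤ E ∑ x_i (∂_i p)²`
for every symmetric polynomial `p`, without any convexity assumption on the density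
(`poincare_of_mem_symmDegreeLE`); for polynomial linear statistics it is the claim with the
constant `2 / (β M N)`.

Self-adjointness is an integration by parts. The density may be singular where a particle hits `0`
or another particle, so the vector field `x_i ∂_i p` is cut off by `χ (n G)`, where `G = ∏ x_i
∏_{i<j} (x_i - x_j)²`. The field `∑ x_i ∂_i p ∂_i` maps `G` to `G` times a polynomial, so the
extra term is a bounded function times a polynomial, tends to `0` pointwise, and disappears by
dominated convergence.

For a `C¹` function `f`, polynomials `u_n` are chosen with `u_n' → f'` and `u_n → f` on the
half-line, controlled by `exp (s x)` (`exists_polynomial_sequence`, which rests on the Weierstrass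
theorem in the variable `exp (-s x / 4)`). The energies converge by domination. On the left,
Fatou's lemma is applied to the mean square difference of two independent copies
(`evariance_le_of_tendsto`). That quantity bounds the extended variance even when the statistic is
not square integrable; it is twice the variance, which turns the constant `2 / (β M N)` into `4 /
(β M N)`.
-/

/-! ### Symmetric polynomials and the Laguerre generator -/

open MvPolynomial in
theorem MvPolynomial.X_sub_X_dvd_of_rename_swap_eq_neg {ι : Type*} [DecidableEq ι] {i j : ι}
    {P : MvPolynomial ι ℝ} (h : rename (Equiv.swap i j) P = -P) : X i - X j ∣ P := by
  set φ : MvPolynomial ι ℝ →ₐ[ℝ] MvPolynomial ι ℝ := aeval (Function.update X i (X j)) with hφ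
  have hswap : φ (rename (Equiv.swap i j) P) = φ P := by
    rw [hφ, aeval_rename]
    congr 2
    funext k
    by_cases hki : k = i
    · subst hki
      by_cases hkj : j = k
      · subst hkj; simp
      · simp [Function.update_of_ne hkj]
    · by_cases hkj : k = j
      · subst hkj; simp [Function.update_of_ne hki]
      · simp [Equiv.swap_apply_of_ne_of_ne hki hkj]
  have hzero : φ P = 0 := by
    rw [h, map_neg] at hswap
    exact self_eq_neg.1 hswap.symm
  have hmk : ∀ Q : MvPolynomial ι ℝ, Ideal.Quotient.mkₐ ℝ (Ideal.span {X i - X j}) (φ Q) =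
      Ideal.Quotient.mkₐ ℝ (Ideal.span {(X i - X j : MvPolynomial ι ℝ)}) Q := by
    intro Q
    rw [← AlgHom.comp_apply]
    congr 1
    ext k
    by_cases hki : k = i
    · subst hki
      simp only [hφ, AlgHom.comp_apply, aeval_X, Function.update_self, Ideal.Quotient.mkₐ_eq_mk]
      symm
      rw [Ideal.Quotient.eq]
      exact Ideal.mem_span_singleton_self _
    · simp [hφ, Function.update_of_ne hki]
  have := hmk P
  rw [hzero, map_zero, eq_comm, Ideal.Quotient.mkₐ_eq_mk, Ideal.Quotient.eq_zero_iff_mem] at this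
  exact Ideal.mem_span_singleton.1 this

namespace LaguerreAlgebra

open MvPolynomial

open Classical in
/-- The divided difference `(X_i ∂_i p - X_j ∂_j p) / (X_i - X_j)`, which is a polynomial when `p`
is symmetric. It is `0` by convention when `i = j` or when the division is not exact. -/
noncomputable def dividedDiff {ι : Type*} (p : MvPolynomial ι ℝ) (i j : ι) : MvPolynomial ι ℝ :=
  if h : i ≠ j ∧ ∃ Q, X i * pderiv i p - X j * pderiv j p = (X i - X j) * Q then h.2.choose else 0

theorem X_sub_X_ne_zero {ι : Type*} {i j : ι} (h : i ≠ j) :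
    (X i - X j : MvPolynomial ι ℝ) ≠ 0 := by
  rw [sub_ne_zero]
  exact fun h' => h (X_injective h')

theorem dividedDiff_self {ι : Type*} (p : MvPolynomial ι ℝ) (i : ι) : dividedDiff p i i = 0 := by
  simp [dividedDiff]

theorem X_sub_X_mul_dividedDiff {ι : Type*} {p : MvPolynomial ι ℝ}
    (hp : p.IsSymmetric) {i j : ι} (hij : i ≠ j) :
    (X i - X j) * dividedDiff p i j = X i * pderiv i p - X j * pderiv j p := by
  classical
  have hdvd : X i - X j ∣ X i * pderiv i p - X j * pderiv j p := by
    apply MvPolynomial.X_sub_X_dvd_of_rename_swap_eq_neg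
    rw [map_sub, map_mul, map_mul, ← pderiv_rename (Equiv.swap i j).injective,
      ← pderiv_rename (Equiv.swap i j).injective, hp, rename_X, rename_X,
      Equiv.swap_apply_left, Equiv.swap_apply_right]
    ring
  have h : i ≠ j ∧ ∃ Q, X i * pderiv i p - X j * pderiv j p = (X i - X j) * Q := ⟨hij, hdvd⟩
  rw [dividedDiff, dif_pos h]
  exact h.2.choose_spec.symm

theorem rename_dividedDiff {ι : Type*} {p : MvPolynomial ι ℝ} (hp : p.IsSymmetric)
    (e : Equiv.Perm ι) (i j : ι) :
    rename e (dividedDiff p i j) = dividedDiff p (e i) (e j) := by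
  by_cases hij : i = j
  · subst hij; simp [dividedDiff_self]
  have hij' : e i ≠ e j := fun h => hij (e.injective h)
  apply mul_left_cancel₀ (X_sub_X_ne_zero hij')
  rw [X_sub_X_mul_dividedDiff hp hij']
  have := congrArg (rename e) (X_sub_X_mul_dividedDiff hp hij)
  simpa only [map_mul, map_sub, rename_X, ← pderiv_rename e.injective, hp e] using this

/-- The symmetric polynomials of total degree at most `k`. -/
noncomputable def symmDegreeLE (ι : Type*) (k : ℕ) : Submodule ℝ (MvPolynomial ι ℝ) :=
  (symmetricSubalgebra ι ℝ).toSubmodule ⊓ restrictTotalDegree ι ℝ k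

theorem mem_symmDegreeLE {ι : Type*} {k : ℕ} {p : MvPolynomial ι ℝ} :
    p ∈ symmDegreeLE ι k ↔ p.IsSymmetric ∧ p.totalDegree ≤ k := by
  rw [symmDegreeLE, Submodule.mem_inf, mem_restrictTotalDegree, Subalgebra.mem_toSubmodule,
    mem_symmetricSubalgebra]

theorem symmDegreeLE_mono {ι : Type*} {k l : ℕ} (h : k ≤ l) :
    symmDegreeLE ι k ≤ symmDegreeLE ι l := fun p hp => by
  rw [mem_symmDegreeLE] at *
  exact ⟨hp.1, hp.2.trans h⟩

instance {ι : Type*} [Finite ι] (k : ℕ) : Module.Finite ℝ (symmDegreeLE ι k) :=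
  Submodule.finiteDimensional_of_le inf_le_right

theorem coeff_X_mul_pderiv {ι : Type*} (i : ι) (p : MvPolynomial ι ℝ) (m : ι →₀ ℕ) :
    (X i * pderiv i p).coeff m = m i * p.coeff m := by
  classical
  induction p using MvPolynomial.induction_on' with
  | monomial n r =>
    rw [X_mul_pderiv_monomial, coeff_smul, coeff_monomial]
    split_ifs with h
    · subst h; simp
    · simp
  | add p q hp hq => simp only [map_add, mul_add, coeff_add, hp, hq]

theorem totalDegree_X_mul_pderiv_le {ι : Type*} (i : ι) (p : MvPolynomial ι ℝ) :
    (X i * pderiv i p).totalDegree ≤ p.totalDegree := by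
  apply totalDegree_le_of_support_subset
  intro m
  simp only [mem_support_iff, coeff_X_mul_pderiv]
  exact fun h h' => h (by simp [h'])

theorem totalDegree_pderiv_le {ι : Type*} {k : ℕ} (i : ι) {p : MvPolynomial ι ℝ}
    (hp : p.totalDegree ≤ k + 1) : (pderiv i p).totalDegree ≤ k := by
  by_cases h0 : pderiv i p = 0
  · simp [h0]
  have := totalDegree_X_mul_pderiv_le i p
  rw [totalDegree_mul_of_isDomain (X_ne_zero i) h0, totalDegree_X] at this
  omega

/-- Euler's identity for homogeneous polynomials, up to terms of lower degree. -/
theorem totalDegree_sum_X_mul_pderiv_sub_le {ι : Type*} [Fintype ι] {k : ℕ}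
    {p : MvPolynomial ι ℝ} (hp : p.totalDegree ≤ k + 1) :
    (∑ i, X i * pderiv i p - C ((k : ℝ) + 1) * p).totalDegree ≤ k := by
  refine Finset.sup_le fun m hm => ?_
  rw [mem_support_iff, coeff_sub, coeff_sum, coeff_C_mul] at hm
  simp only [coeff_X_mul_pderiv, ← Finset.sum_mul, ← sub_mul] at hm
  have h1 := left_ne_zero_of_mul hm
  have h2 := right_ne_zero_of_mul hm
  have h3 : m.degree ≤ k + 1 :=
    (le_totalDegree (mem_support_iff.2 h2)).trans hp
  have h4 : m.degree ≠ k + 1 := by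
    intro h
    apply h1
    rw [Finsupp.degree_eq_sum] at h
    rw [sub_eq_zero]
    exact_mod_cast h
  have : m.degree ≤ k := by omega
  rwa [Finsupp.degree] at this

theorem totalDegree_dividedDiff_le {ι : Type*} {k : ℕ}
    {p : MvPolynomial ι ℝ} (hs : p.IsSymmetric) (hp : p.totalDegree ≤ k + 1) (i j : ι) :
    (dividedDiff p i j).totalDegree ≤ k := by
  by_cases hij : i = j
  · subst hij; simp [dividedDiff_self]
  by_cases h0 : dividedDiff p i j = 0
  · simp [h0]
  have h := congrArg totalDegree (X_sub_X_mul_dividedDiff hs hij)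
  rw [totalDegree_mul_of_isDomain (X_sub_X_ne_zero hij) h0] at h
  have h1 : (X i * pderiv i p - X j * pderiv j p).totalDegree ≤ k + 1 :=
    (totalDegree_sub _ _).trans (max_le ((totalDegree_X_mul_pderiv_le i p).trans hp)
      ((totalDegree_X_mul_pderiv_le j p).trans hp))
  have h2 : (X i - X j : MvPolynomial ι ℝ).totalDegree ≠ 0 := by
    intro h2
    have h3 := totalDegree_eq_zero_iff_eq_C.1 h2
    have h4 := congrArg (pderiv i) h3
    classical
    rw [map_sub, pderiv_X_self, pderiv_X_of_ne (Ne.symm hij), pderiv_C] at h4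
    simp at h4
  omega

/-- The generator `∑ x_i ∂_i² + ∑ (a - b x_i) ∂_i + c ∑_{i<j} (x_i ∂_i - x_j ∂_j) / (x_i - x_j)` of
the Laguerre diffusion, acting on symmetric polynomials. -/
noncomputable def generator {ι : Type*} [Fintype ι] (a b c : ℝ) (p : MvPolynomial ι ℝ) :
    MvPolynomial ι ℝ :=
  ∑ i, X i * pderiv i (pderiv i p) + C a * ∑ i, pderiv i p - C b * ∑ i, X i * pderiv i p +
    C (c / 2) * ∑ i, ∑ j, dividedDiff p i j

theorem isSymmetric_generator {ι : Type*} [Fintype ι] (a b c : ℝ) {p : MvPolynomial ι ℝ}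
    (hp : p.IsSymmetric) : (generator a b c p).IsSymmetric := by
  have hsum : ∀ f : ι → MvPolynomial ι ℝ, (∀ (e : Equiv.Perm ι) i, rename e (f i) = f (e i)) →
      (∑ i, f i).IsSymmetric := by
    intro f hf e
    rw [map_sum]
    simp only [hf]
    exact Equiv.sum_comp e f
  have hpd : ∀ (e : Equiv.Perm ι) i, rename e (pderiv i p) = pderiv (e i) p := by
    intro e i
    rw [← pderiv_rename e.injective, hp e]
  have h1 := hsum (fun i => X i * pderiv i (pderiv i p)) fun e i => by
    rw [map_mul, rename_X, ← pderiv_rename e.injective, hpd]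
  have h2 := hsum (fun i => pderiv i p) hpd
  have h3 := hsum (fun i => X i * pderiv i p) fun e i => by rw [map_mul, rename_X, hpd]
  have h4 := hsum (fun i => ∑ j, dividedDiff p i j) fun e i => by
    rw [map_sum]
    simp only [rename_dividedDiff hp]
    exact Equiv.sum_comp e fun j => dividedDiff p (e i) j
  exact ((h1.add ((MvPolynomial.IsSymmetric.C a).mul h2)).sub
    ((MvPolynomial.IsSymmetric.C b).mul h3)).add ((MvPolynomial.IsSymmetric.C (c / 2)).mul h4)

/-- The generator is triangular with respect to the degree filtration: modulo symmetric polynomials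
of lower degree it acts on degree `k + 1` as the scalar `-b (k + 1)`. -/
theorem generator_add_mem {ι : Type*} [Fintype ι] (a b c : ℝ) {k : ℕ} {p : MvPolynomial ι ℝ}
    (hp : p ∈ symmDegreeLE ι (k + 1)) :
    generator a b c p + C (b * (k + 1)) * p ∈ symmDegreeLE ι k := by
  obtain ⟨hs, hd⟩ := mem_symmDegreeLE.1 hp
  rw [mem_symmDegreeLE]
  refine ⟨(isSymmetric_generator a b c hs).add ((MvPolynomial.IsSymmetric.C _).mul hs), ?_⟩
  have key : generator a b c p + C (b * (k + 1)) * p =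
      ∑ i, X i * pderiv i (pderiv i p) + C a * ∑ i, pderiv i p
        - C b * (∑ i, X i * pderiv i p - C ((k : ℝ) + 1) * p) +
      C (c / 2) * ∑ i, ∑ j, dividedDiff p i j := by
    rw [generator, C_mul]; ring
  rw [key, ← mem_restrictTotalDegree]
  have hC : ∀ (r : ℝ) {q : MvPolynomial ι ℝ}, q ∈ restrictTotalDegree ι ℝ k →
      C r * q ∈ restrictTotalDegree ι ℝ k := by
    intro r q hq
    rw [C_mul']
    exact Submodule.smul_mem _ _ hq
  refine Submodule.add_mem _ (Submodule.sub_mem _ (Submodule.add_mem _ ?_ (hC _ ?_)) (hC _ ?_))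
    (hC _ ?_)
  · refine Submodule.sum_mem _ fun i _ => ?_
    rw [mem_restrictTotalDegree]
    exact (totalDegree_X_mul_pderiv_le i _).trans (totalDegree_pderiv_le i hd)
  · refine Submodule.sum_mem _ fun i _ => ?_
    rw [mem_restrictTotalDegree]
    exact totalDegree_pderiv_le i hd
  · rw [mem_restrictTotalDegree]
    exact totalDegree_sum_X_mul_pderiv_sub_le hd
  · refine Submodule.sum_mem _ fun i _ => Submodule.sum_mem _ fun j _ => ?_
    rw [mem_restrictTotalDegree]
    exact totalDegree_dividedDiff_le hs hd i j

end LaguerreAlgebra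

/-! ### Growth and integrability with respect to the ensemble -/

namespace LaguerreEnsemble

open MeasureTheory

/-- The open positive orthant of `ℝ^N`. -/
abbrev posOrthant (N : ℕ) : Set (Fin N → ℝ) := {x | ∀ i, 0 < x i}

/-- A function on `ℝ^N` which on the positive orthant grows slower than every exponential
`exp (t ∑ x_i)` with `t > 0`. -/
def Subexponential {N : ℕ} (φ : (Fin N → ℝ) → ℝ) : Prop :=
  ∀ t : ℝ, 0 < t → ∃ C : ℝ, 0 ≤ C ∧ ∀ x ∈ posOrthant N, |φ x| ≤ C * Real.exp (t * ∑ i, x i)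

theorem sum_nonneg_of_mem_posOrthant {N : ℕ} {x : Fin N → ℝ} (hx : x ∈ posOrthant N) :
    0 ≤ ∑ i, x i := Finset.sum_nonneg fun i _ => (hx i).le

namespace Subexponential

variable {N : ℕ} {φ ψ : (Fin N → ℝ) → ℝ}

theorem mono (hφ : Subexponential φ) (h : ∀ x ∈ posOrthant N, |ψ x| ≤ |φ x|) :
    Subexponential ψ := fun t ht => by
  obtain ⟨C, hC, h1⟩ := hφ t ht
  exact ⟨C, hC, fun x hx => (h x hx).trans (h1 x hx)⟩

theorem const (c : ℝ) : Subexponential (fun _ : Fin N → ℝ => c) := fun t ht => by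
  refine ⟨|c|, abs_nonneg c, fun x hx => ?_⟩
  have : 1 ≤ Real.exp (t * ∑ i, x i) :=
    Real.one_le_exp (mul_nonneg ht.le (sum_nonneg_of_mem_posOrthant hx))
  nlinarith [abs_nonneg c]

theorem add (hφ : Subexponential φ) (hψ : Subexponential ψ) :
    Subexponential (fun x => φ x + ψ x) := fun t ht => by
  obtain ⟨C, hC, h1⟩ := hφ t ht
  obtain ⟨D, hD, h2⟩ := hψ t ht
  refine ⟨C + D, add_nonneg hC hD, fun x hx => (abs_add_le _ _).trans ?_⟩
  rw [add_mul]
  exact add_le_add (h1 x hx) (h2 x hx)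

theorem mul (hφ : Subexponential φ) (hψ : Subexponential ψ) :
    Subexponential (fun x => φ x * ψ x) := fun t ht => by
  obtain ⟨C, hC, h1⟩ := hφ (t / 2) (half_pos ht)
  obtain ⟨D, hD, h2⟩ := hψ (t / 2) (half_pos ht)
  refine ⟨C * D, mul_nonneg hC hD, fun x hx => ?_⟩
  rw [abs_mul]
  calc |φ x| * |ψ x| ≤ (C * Real.exp (t / 2 * ∑ i, x i)) * (D * Real.exp (t / 2 * ∑ i, x i)) :=
        mul_le_mul (h1 x hx) (h2 x hx) (abs_nonneg _) (by positivity)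
    _ = C * D * Real.exp (t * ∑ i, x i) := by
        rw [mul_mul_mul_comm, ← Real.exp_add]; congr 2; ring

theorem finset_prod {κ : Type*} (s : Finset κ) {f : κ → (Fin N → ℝ) → ℝ}
    (hf : ∀ k ∈ s, Subexponential (f k)) : Subexponential (fun x => ∏ k ∈ s, f k x) := by
  classical
  induction s using Finset.induction_on with
  | empty => simpa using const (N := N) 1
  | insert k s hk ih =>
    simp only [Finset.prod_insert hk]
    exact (hf k (Finset.mem_insert_self _ _)).mul
      (ih fun l hl => hf l (Finset.mem_insert_of_mem hl))

theorem sum_coord : Subexponential (fun x : Fin N → ℝ => ∑ i, x i) := fun t ht => by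
  refine ⟨1 / t, by positivity, fun x hx => ?_⟩
  rw [abs_of_nonneg (sum_nonneg_of_mem_posOrthant hx), div_mul_eq_mul_div, one_mul, le_div_iff₀ ht]
  linarith [Real.add_one_le_exp (t * ∑ i, x i)]

theorem coord (i : Fin N) : Subexponential (fun x : Fin N → ℝ => x i) :=
  sum_coord.mono fun x hx => by
    rw [abs_of_pos (hx i), abs_of_nonneg (sum_nonneg_of_mem_posOrthant hx)]
    exact Finset.single_le_sum (f := x) (fun j _ => (hx j).le) (Finset.mem_univ i)

theorem abs_rpow (hφ : Subexponential φ) {β : ℝ} (hβ : 0 < β) :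
    Subexponential (fun x => |φ x| ^ β) := fun t ht => by
  obtain ⟨C, hC, h⟩ := hφ (t / β) (div_pos ht hβ)
  refine ⟨C ^ β, Real.rpow_nonneg hC β, fun x hx => ?_⟩
  rw [abs_of_nonneg (Real.rpow_nonneg (abs_nonneg _) β)]
  calc |φ x| ^ β ≤ (C * Real.exp (t / β * ∑ i, x i)) ^ β :=
        Real.rpow_le_rpow (abs_nonneg _) (h x hx) hβ.le
    _ = C ^ β * Real.exp (t * ∑ i, x i) := by
        rw [Real.mul_rpow hC (Real.exp_pos _).le, ← Real.exp_mul]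
        congr 2
        field_simp

theorem eval (p : MvPolynomial (Fin N) ℝ) : Subexponential (fun x => MvPolynomial.eval x p) := by
  induction p using MvPolynomial.induction_on with
  | C c => simpa using const c
  | add p q hp hq => simpa using hp.add hq
  | mul_X p i hp => simpa using hp.mul (coord i)

end Subexponential

variable {N : ℕ} {M β : ℝ}

theorem laguerreWeight_nonneg {x : Fin N → ℝ} (hx : x ∈ posOrthant N) :
    0 ≤ laguerreWeight N M β x := by
  refine mul_nonneg (Finset.prod_nonneg fun i _ => Finset.prod_nonneg fun j _ =>
    Real.rpow_nonneg (abs_nonneg _) _) (Finset.prod_nonneg fun i _ => ?_)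
  exact mul_nonneg (Real.rpow_nonneg (hx i).le _) (Real.exp_pos _).le

theorem laguerreWeight_pos {x : Fin N → ℝ} (hx : x ∈ posOrthant N) (hinj : Function.Injective x) :
    0 < laguerreWeight N M β x := by
  refine mul_pos (Finset.prod_pos fun i _ => Finset.prod_pos fun j hj =>
    Real.rpow_pos_of_pos (abs_pos.2 (sub_ne_zero.2 ?_)) _) (Finset.prod_pos fun i _ => ?_)
  · exact hinj.ne (Finset.mem_Ioi.1 hj).ne'
  · exact mul_pos (Real.rpow_pos_of_pos (hx i) _) (Real.exp_pos _)

theorem measurable_laguerreWeight : Measurable (laguerreWeight N M β) := by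
  unfold laguerreWeight
  fun_prop

theorem measurableSet_posOrthant : MeasurableSet (posOrthant N) := by
  have : posOrthant N = ⋂ i, {x | 0 < x i} := by ext; simp
  rw [this]
  exact MeasurableSet.iInter fun i => measurableSet_lt measurable_const (measurable_pi_apply i)

theorem isOpen_posOrthant : IsOpen (posOrthant N) := by
  have : posOrthant N = ⋂ i, {x | 0 < x i} := by ext; simp
  rw [this]
  exact isOpen_iInter_of_finite fun i => isOpen_lt continuous_const (continuous_apply i)

theorem integrable_laguerreUnnormalized_iff {φ : (Fin N → ℝ) → ℝ} :
    Integrable φ (laguerreUnnormalized N M β) ↔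
      IntegrableOn (fun x => laguerreWeight N M β x * φ x) (posOrthant N) := by
  rw [laguerreUnnormalized, integrable_withDensity_iff_integrable_smul'
    measurable_laguerreWeight.ennreal_ofReal (by simp)]
  refine integrable_congr ?_
  filter_upwards [ae_restrict_mem measurableSet_posOrthant] with x hx
  rw [ENNReal.toReal_ofReal (laguerreWeight_nonneg hx), smul_eq_mul]

theorem integral_laguerreUnnormalized (φ : (Fin N → ℝ) → ℝ) :
    ∫ x, φ x ∂(laguerreUnnormalized N M β) =
      ∫ x in posOrthant N, laguerreWeight N M β x * φ x := by
  rw [laguerreUnnormalized, integral_withDensity_eq_integral_toReal_smul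
    measurable_laguerreWeight.ennreal_ofReal (by simp)]
  refine integral_congr_ae ?_
  filter_upwards [ae_restrict_mem measurableSet_posOrthant] with x hx
  rw [ENNReal.toReal_ofReal (laguerreWeight_nonneg hx), smul_eq_mul]

theorem integrableOn_prod_rpow_mul_exp {s b : ℝ} (hs : -1 < s) (hb : 0 < b) :
    IntegrableOn (fun x : Fin N → ℝ => ∏ i, (x i ^ s * Real.exp (-b * x i))) (posOrthant N) := by
  have h1 : Integrable ((Set.Ioi (0 : ℝ)).indicator fun u => u ^ s * Real.exp (-b * u)) := by
    rw [integrable_indicator_iff measurableSet_Ioi]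
    simpa using integrableOn_rpow_mul_exp_neg_mul_rpow hs one_pos hb
  have h2 := Integrable.fintype_prod (ι := Fin N) (f := fun _ => (Set.Ioi (0 : ℝ)).indicator
    fun u => u ^ s * Real.exp (-b * u)) (μ := fun _ => volume) (fun _ => h1)
  refine IntegrableOn.congr_fun (s := posOrthant N) (Integrable.integrableOn h2) ?_
    measurableSet_posOrthant
  intro x hx
  exact Finset.prod_congr rfl fun i _ => Set.indicator_of_mem (Set.mem_Ioi.2 (hx i)) _

/-- Functions of exponential growth rate less than `β M / 2` are integrable: the interaction factor
is subexponential, so the density is bounded by a product of Gamma densities. -/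
theorem integrable_of_abs_le_exp (hβ : 0 < β) (hM : (N : ℝ) - 1 < M)
    {φ : (Fin N → ℝ) → ℝ} (hφ : Measurable φ) {C t : ℝ} (ht : t < β * M / 2)
    (hbound : ∀ x ∈ posOrthant N, |φ x| ≤ C * Real.exp (t * ∑ i, x i)) :
    Integrable φ (laguerreUnnormalized N M β) := by
  rw [integrable_laguerreUnnormalized_iff]
  have hint : Subexponential (fun x : Fin N → ℝ =>
      ∏ i : Fin N, ∏ j ∈ Finset.Ioi i, |x j - x i| ^ β) :=
    Subexponential.finset_prod _ fun i _ => Subexponential.finset_prod _ fun j _ => by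
      have h := (Subexponential.coord j).add ((Subexponential.const (-1)).mul
        (Subexponential.coord i))
      refine (h.abs_rpow hβ).mono fun x _ => ?_
      rw [neg_one_mul, ← sub_eq_add_neg]
  obtain ⟨D, hD, hDb⟩ := hint ((β * M / 2 - t) / 2) (by linarith)
  have hs : -1 < β / 2 * (M - N + 1) - 1 := by
    have : 0 < β / 2 * (M - N + 1) := mul_pos (half_pos hβ) (by linarith)
    linarith
  have key := (integrableOn_prod_rpow_mul_exp (N := N) hs
    (b := (β * M / 2 - t) / 2) (by linarith)).const_mul (D * C)
  refine Integrable.mono' key (measurable_laguerreWeight.mul hφ).aestronglyMeasurable ?_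
  filter_upwards [ae_restrict_mem measurableSet_posOrthant] with x hx
  rw [Real.norm_eq_abs, abs_mul, laguerreWeight, abs_mul,
    abs_of_nonneg (a := ∏ i : Fin N, (_ : ℝ)) (Finset.prod_nonneg fun i _ =>
      mul_nonneg (Real.rpow_nonneg (hx i).le _) (Real.exp_pos _).le)]
  have hP : 0 ≤ ∏ i : Fin N, (x i ^ (β / 2 * (M - N + 1) - 1) *
      Real.exp (-(β * M / 2) * x i)) := Finset.prod_nonneg fun i _ =>
      mul_nonneg (Real.rpow_nonneg (hx i).le _) (Real.exp_pos _).le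
  calc _ ≤ (D * Real.exp ((β * M / 2 - t) / 2 * ∑ i, x i)) *
        (∏ i : Fin N, (x i ^ (β / 2 * (M - N + 1) - 1) * Real.exp (-(β * M / 2) * x i))) *
        (C * Real.exp (t * ∑ i, x i)) := by
        refine mul_le_mul (mul_le_mul_of_nonneg_right (hDb x hx) hP) (hbound x hx)
          (abs_nonneg _) (by positivity)
    _ = _ := by
        simp only [Finset.prod_mul_distrib, ← Real.exp_sum, ← Finset.mul_sum]
        have : Real.exp (-((β * M / 2 - t) / 2) * ∑ i, x i) =
          Real.exp ((β * M / 2 - t) / 2 * ∑ i, x i) * Real.exp (-(β * M / 2) * ∑ i, x i) *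
            Real.exp (t * ∑ i, x i) := by
          rw [← Real.exp_add, ← Real.exp_add]; congr 1; ring
        rw [this]
        ring

theorem rate_pos (hN : 1 ≤ N) (hβ : 0 < β) (hM : (N : ℝ) - 1 < M) : 0 < β * M / 2 := by
  have : (1 : ℝ) ≤ N := by exact_mod_cast hN
  have : 0 < M := by linarith
  positivity

theorem Subexponential.integrable (hN : 1 ≤ N) (hβ : 0 < β) (hM : (N : ℝ) - 1 < M)
    {φ : (Fin N → ℝ) → ℝ} (hφ : Measurable φ) (h : Subexponential φ) :
    Integrable φ (laguerreUnnormalized N M β) := by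
  have hb := rate_pos hN hβ hM
  obtain ⟨C, -, hC⟩ := h (β * M / 2 / 2) (by linarith)
  exact integrable_of_abs_le_exp hβ hM hφ (by linarith) hC

theorem measurable_eval (p : MvPolynomial (Fin N) ℝ) :
    Measurable (fun x => MvPolynomial.eval x p) := (MvPolynomial.continuous_eval p).measurable

theorem isFiniteMeasure_laguerreUnnormalized (hN : 1 ≤ N) (hβ : 0 < β) (hM : (N : ℝ) - 1 < M) :
    IsFiniteMeasure (laguerreUnnormalized N M β) := by
  have := (Subexponential.const (N := N) 1).integrable hN hβ hM measurable_const
  exact (integrable_const_iff_isFiniteMeasure one_ne_zero).1 this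

theorem ae_injective : ∀ᵐ x : Fin N → ℝ, Function.Injective x := by
  have h : ∀ i j : Fin N, i ≠ j → ∀ᵐ x : Fin N → ℝ, x i ≠ x j := by
    intro i j hij
    let L : (Fin N → ℝ) →ₗ[ℝ] ℝ :=
      (LinearMap.proj i : (Fin N → ℝ) →ₗ[ℝ] ℝ) - LinearMap.proj j
    have hL : LinearMap.ker L ≠ ⊤ := by
      intro h
      have : (Pi.single i 1 : Fin N → ℝ) ∈ LinearMap.ker L := h ▸ Submodule.mem_top
      simp [L, hij] at this
    have := Measure.addHaar_submodule (volume : Measure (Fin N → ℝ)) (LinearMap.ker L) hL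
    rw [ae_iff]
    convert this using 2
    ext x
    simp [L, sub_eq_zero]
  have h' : ∀ᵐ x : Fin N → ℝ, ∀ i j : Fin N, i ≠ j → x i ≠ x j := by
    rw [ae_all_iff]; intro i
    rw [ae_all_iff]; intro j
    by_cases hij : i = j
    · simp [hij]
    · simpa [hij] using h i j hij
  filter_upwards [h'] with x hx i j hij
  by_contra hne
  exact hx i j hne hij

theorem ae_mem_posOrthant : ∀ᵐ x ∂(laguerreUnnormalized N M β), x ∈ posOrthant N :=
  (withDensity_absolutelyContinuous _ _).ae_le (ae_restrict_mem measurableSet_posOrthant)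

theorem laguerreZ_ne_zero : laguerreZ N M β ≠ 0 := by
  intro h
  rw [laguerreZ, Measure.measure_univ_eq_zero, laguerreUnnormalized,
    withDensity_eq_zero_iff measurable_laguerreWeight.ennreal_ofReal.aemeasurable] at h
  have h1 : ∀ᵐ x ∂(volume.restrict (posOrthant N)), False := by
    filter_upwards [h, ae_restrict_mem measurableSet_posOrthant,
      ae_restrict_of_ae ae_injective] with x hx hx1 hx2
    have := laguerreWeight_pos (M := M) (β := β) hx1 hx2
    simp only [Pi.zero_apply, ENNReal.ofReal_eq_zero] at hx
    linarith
  rw [Filter.eventually_false_iff_eq_bot, ae_eq_bot, Measure.restrict_eq_zero] at h1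
  exact (isOpen_posOrthant.measure_pos volume ⟨fun _ => 1, fun _ => one_pos⟩).ne' h1

theorem isProbabilityMeasure_betaLaguerre (hN : 1 ≤ N) (hβ : 0 < β) (hM : (N : ℝ) - 1 < M) :
    IsProbabilityMeasure (betaLaguerre N M β) := by
  have := isFiniteMeasure_laguerreUnnormalized hN hβ hM
  refine ⟨?_⟩
  rw [betaLaguerre, Measure.smul_apply, smul_eq_mul, ← laguerreZ]
  exact ENNReal.inv_mul_cancel laguerreZ_ne_zero (measure_ne_top _ _)

end LaguerreEnsemble

/-! ### Calculus of the density and of the gauge -/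

theorem MvPolynomial.hasLineDerivAt_eval {ι : Type*} [DecidableEq ι] (p : MvPolynomial ι ℝ)
    (x : ι → ℝ) (i : ι) :
    HasLineDerivAt ℝ (fun y => eval y p) (eval x (pderiv i p)) x (Pi.single i 1) := by
  induction p using MvPolynomial.induction_on with
  | C c => simpa [HasLineDerivAt] using hasDerivAt_const (0 : ℝ) c
  | add p q hp hq =>
    simpa [HasLineDerivAt] using HasDerivAt.fun_add hp hq
  | mul_X p k hp =>
    have h : HasDerivAt (fun t : ℝ => (x + t • (Pi.single i (1 : ℝ) : _ → ℝ)) k)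
        ((Pi.single i (1 : ℝ) : ι → ℝ) k) 0 := by
      have := ((hasDerivAt_id (0 : ℝ)).mul_const ((Pi.single i (1 : ℝ) : ι → ℝ) k)).const_add (x k)
      simpa using this
    have h2 := HasDerivAt.mul hp h
    have : ∀ y : ι → ℝ, eval y (p * X k) = eval y p * y k := fun y => by simp
    rw [HasLineDerivAt]
    simp only [this]
    refine h2.congr_deriv ?_
    rw [pderiv_mul, pderiv_X]
    simp only [zero_smul, add_zero, map_add, map_mul, eval_X]
    congr 2
    by_cases hk : k = i
    · subst hk; simp
    · simp [hk]

/-- A smooth cutoff `χ` vanishing on `(-∞, 1]` and equal to `1` on `[2, ∞)`, with derivative `χ'`,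
such that `s χ' s` is bounded: the bound is what survives under the rescalings `s ↦ χ (n s)`. -/
theorem exists_cutoff : ∃ χ χ' : ℝ → ℝ, (∀ s, HasDerivAt χ (χ' s) s) ∧ Continuous χ' ∧
    (∀ s, |χ s| ≤ 1) ∧ (∀ s ≤ 1, χ s = 0 ∧ χ' s = 0) ∧ (∀ s, 2 < s → χ s = 1 ∧ χ' s = 0) ∧
    ∃ K, ∀ s, |s * χ' s| ≤ K := by
  set χ : ℝ → ℝ := fun s => Real.smoothTransition (s - 1) with hχ
  have hsm : ContDiff ℝ 1 χ := Real.smoothTransition.contDiff.comp (contDiff_id.sub contDiff_const)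
  have hd : ∀ s, HasDerivAt χ (deriv χ s) s := fun s =>
    (hsm.differentiable one_ne_zero s).hasDerivAt
  have hc : Continuous (deriv χ) := hsm.continuous_deriv le_rfl
  have h0 : ∀ s ≤ 1, χ s = 0 := fun s hs => Real.smoothTransition.zero_of_nonpos (by linarith)
  have h1 : ∀ s, 2 < s → χ s = 1 := fun s hs => Real.smoothTransition.one_of_one_le (by linarith)
  have hd0' : ∀ s < 1, deriv χ s = 0 := fun s hs => by
    have : χ =ᶠ[nhds s] fun _ => 0 := by
      filter_upwards [Iio_mem_nhds hs] with u hu using h0 u (le_of_lt hu)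
    rw [this.deriv_eq, deriv_const]
  have hd0 : ∀ s ≤ 1, deriv χ s = 0 := by
    intro s hs
    have hcl : IsClosed {s | deriv χ s = 0} := isClosed_eq hc continuous_const
    have : closure (Set.Iio (1 : ℝ)) ⊆ {s | deriv χ s = 0} :=
      hcl.closure_subset_iff.2 fun s hs => hd0' s hs
    rw [closure_Iio] at this
    exact this hs
  have hd1 : ∀ s, 2 < s → deriv χ s = 0 := fun s hs => by
    have : χ =ᶠ[nhds s] fun _ => 1 := by
      filter_upwards [Ioi_mem_nhds hs] with u hu using h1 u hu
    rw [this.deriv_eq, deriv_const]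
  obtain ⟨K, hK⟩ := (isCompact_Icc (a := (1 : ℝ)) (b := 2)).exists_bound_of_continuousOn
    (f := fun s => s * deriv χ s) (continuous_id.mul hc).continuousOn
  refine ⟨χ, deriv χ, hd, hc, fun s => ?_, fun s hs => ⟨h0 s hs, hd0 s hs⟩,
    fun s hs => ⟨h1 s hs, hd1 s hs⟩, max K 0, fun s => ?_⟩
  · rw [abs_of_nonneg (Real.smoothTransition.nonneg _)]
    exact Real.smoothTransition.le_one _
  · by_cases hs : s ∈ Set.Icc (1 : ℝ) 2
    · exact (hK s hs).trans (le_max_left _ _)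
    · have : deriv χ s = 0 := by
        rw [Set.mem_Icc, not_and_or, not_le, not_le] at hs
        exact hs.elim (fun h => hd0 s h.le) (hd1 s)
      simp [this]

namespace LaguerreEnsemble

open MeasureTheory Filter Topology

variable {N : ℕ} {M β : ℝ}

/-- The logarithm of the weight `∏ x_k^α e^(-b x_k) * ∏_{k<j} |x_j - x_k|^γ`. The sum runs over all
pairs, whence the factor `γ / 2`; the diagonal terms vanish because `Real.log 0 = 0`. -/
noncomputable def logWeight (α γ b : ℝ) (x : Fin N → ℝ) : ℝ :=
  ∑ k, (α * Real.log (x k) - b * x k) + γ / 2 * ∑ k, ∑ j, Real.log (x j - x k)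

theorem hasLineDerivAt_logWeight (α γ b : ℝ) {x : Fin N → ℝ} (hx : x ∈ posOrthant N)
    (hinj : Function.Injective x) (i : Fin N) :
    HasLineDerivAt ℝ (logWeight α γ b) (α / x i - b + γ * ∑ j, 1 / (x i - x j)) x
      (Pi.single i 1) := by
  have hcoord : ∀ k, HasDerivAt (fun t : ℝ => (x + t • (Pi.single i (1 : ℝ) : _ → ℝ)) k)
      ((Pi.single i (1 : ℝ) : Fin N → ℝ) k) 0 := fun k => by
    have := ((hasDerivAt_id (0 : ℝ)).mul_const
      ((Pi.single i (1 : ℝ) : Fin N → ℝ) k)).const_add (x k)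
    simpa using this
  set δ : Fin N → ℝ := Pi.single i (1 : ℝ) with hδ
  have hlog : ∀ k, HasDerivAt (fun t : ℝ => Real.log ((x + t • δ) k)) (δ k / x k) 0 := fun k => by
    have := (hcoord k).log (by simpa using (hx k).ne')
    simpa using this
  have hpair : ∀ k j, HasDerivAt (fun t : ℝ => Real.log ((x + t • δ) j - (x + t • δ) k))
      ((δ j - δ k) / (x j - x k)) 0 := fun k j => by
    by_cases hjk : j = k
    · subst hjk
      simpa using hasDerivAt_const (0 : ℝ) (0 : ℝ)
    · have := ((hcoord j).fun_sub (hcoord k)).log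
        (by simpa [sub_eq_zero] using hinj.ne hjk)
      simpa using this
  have h1 : HasDerivAt (fun t : ℝ => ∑ k, (α * Real.log ((x + t • δ) k) - b * (x + t • δ) k))
      (∑ k, (α * (δ k / x k) - b * δ k)) 0 :=
    HasDerivAt.fun_sum fun k _ => ((hlog k).const_mul α).sub ((hcoord k).const_mul b)
  have h2 : HasDerivAt (fun t : ℝ => ∑ k, ∑ j, Real.log ((x + t • δ) j - (x + t • δ) k))
      (∑ k, ∑ j, (δ j - δ k) / (x j - x k)) 0 :=
    HasDerivAt.fun_sum fun k _ => HasDerivAt.fun_sum fun j _ => hpair k j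
  have h3 := h1.add (h2.const_mul (γ / 2))
  refine HasDerivAt.congr_deriv h3 ?_
  have e1 : ∑ k, (α * (δ k / x k) - b * δ k) = α / x i - b := by
    rw [Finset.sum_eq_single i]
    · simp [hδ]; ring
    · intro k _ hk; simp [hδ, hk]
    · simp
  have e2 : ∑ k, ∑ j, (δ j - δ k) / (x j - x k) = 2 * ∑ j, 1 / (x i - x j) := by
    simp only [sub_div, Finset.sum_sub_distrib]
    have hA : ∑ k, ∑ j, δ j / (x j - x k) = ∑ k, 1 / (x i - x k) := by
      refine Finset.sum_congr rfl fun k _ => ?_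
      rw [Finset.sum_eq_single i]
      · simp [hδ]
      · intro j _ hj; simp [hδ, hj]
      · simp
    have hB : ∑ k, ∑ j, δ k / (x j - x k) = -∑ j, 1 / (x i - x j) := by
      rw [Finset.sum_eq_single i]
      · rw [← Finset.sum_neg_distrib]
        refine Finset.sum_congr rfl fun j _ => ?_
        rw [← neg_sub (x i) (x j), div_neg]
        simp [hδ]
      · intro j _ hj; simp [hδ, hj]
      · simp
    rw [hA, hB]; ring
  rw [e1, e2]; ring

theorem prod_abs_sub_rpow_eq_exp (γ : ℝ) {x : Fin N → ℝ} (hinj : Function.Injective x) :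
    ∏ i : Fin N, ∏ j ∈ Finset.Ioi i, |x j - x i| ^ γ =
      Real.exp (γ / 2 * ∑ k, ∑ j, Real.log (x j - x k)) := by
  have h1 : ∀ i : Fin N, ∀ j ∈ Finset.Ioi i,
      |x j - x i| ^ γ = Real.exp (γ * Real.log (x j - x i)) := by
    intro i j hj
    have : 0 < |x j - x i| := abs_pos.2 (sub_ne_zero.2 (hinj.ne (Finset.mem_Ioi.1 hj).ne'))
    rw [Real.rpow_def_of_pos this, Real.log_abs, mul_comm]
  rw [Finset.prod_congr rfl fun i _ => Finset.prod_congr rfl (h1 i)]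
  simp only [← Real.exp_sum, ← Finset.mul_sum]
  congr 1
  have h2 := Finset.sum_sum_Ioi_add_eq_sum_sum_off_diag
    (fun j i : Fin N => Real.log (x j - x i))
  have h3 : ∀ i j : Fin N, Real.log (x j - x i) + Real.log (x i - x j) =
      2 * Real.log (x j - x i) := fun i j => by
    rw [← neg_sub (x j) (x i), Real.log_neg_eq_log]; ring
  simp only [h3, ← Finset.mul_sum] at h2
  have h4 : ∑ i : Fin N, ∑ j ∈ {i}ᶜ, Real.log (x j - x i) =
      ∑ i : Fin N, ∑ j, Real.log (x j - x i) := by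
    refine Finset.sum_congr rfl fun i _ => ?_
    refine Finset.sum_subset (Finset.subset_univ _) fun j _ hj => ?_
    have : j = i := by simpa using hj
    simp [this]
  rw [h4] at h2
  rw [← h2]; ring

theorem laguerreWeight_eq_exp {x : Fin N → ℝ} (hx : x ∈ posOrthant N)
    (hinj : Function.Injective x) :
    laguerreWeight N M β x =
      Real.exp (logWeight (β / 2 * (M - N + 1) - 1) β (β * M / 2) x) := by
  rw [laguerreWeight, prod_abs_sub_rpow_eq_exp β hinj, logWeight, Real.exp_add, mul_comm,
    Real.exp_sum]
  congr 1
  refine Finset.prod_congr rfl fun i _ => ?_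
  rw [Real.rpow_def_of_pos (hx i), ← Real.exp_add]
  congr 1; ring

/-- The polynomial `∏ x_k * ∏_{k<j} (x_j - x_k)^2`. On the closed orthant it vanishes exactly where
the Laguerre density may fail to be differentiable. -/
noncomputable def gauge (N : ℕ) : MvPolynomial (Fin N) ℝ :=
  (∏ i, MvPolynomial.X i) *
    ∏ i, ∏ j ∈ Finset.Ioi i, (MvPolynomial.X j - MvPolynomial.X i) ^ 2

theorem eval_gauge (x : Fin N → ℝ) : MvPolynomial.eval x (gauge N) =
    (∏ i, x i) * ∏ i, ∏ j ∈ Finset.Ioi i, (x j - x i) ^ 2 := by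
  simp [gauge]

theorem eval_gauge_eq_exp {x : Fin N → ℝ} (hx : x ∈ posOrthant N)
    (hinj : Function.Injective x) :
    MvPolynomial.eval x (gauge N) = Real.exp (logWeight 1 2 0 x) := by
  have h := prod_abs_sub_rpow_eq_exp 2 hinj
  simp only [Real.rpow_two, sq_abs] at h
  rw [eval_gauge, h, logWeight, Real.exp_add, Real.exp_sum]
  congr 1
  refine Finset.prod_congr rfl fun i _ => ?_
  rw [one_mul, zero_mul, sub_zero, Real.exp_log (hx i)]

theorem injective_of_eval_gauge_ne_zero {x : Fin N → ℝ}
    (h : MvPolynomial.eval x (gauge N) ≠ 0) : Function.Injective x := by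
  have key : ∀ i j : Fin N, i < j → x i ≠ x j := by
    intro i j hij heq
    apply h
    rw [eval_gauge]
    refine mul_eq_zero_of_right _ (Finset.prod_eq_zero (Finset.mem_univ i)
      (Finset.prod_eq_zero (Finset.mem_Ioi.2 hij) ?_))
    rw [heq, sub_self, zero_pow two_ne_zero]
  intro i j hij
  rcases lt_trichotomy i j with h1 | h1 | h1
  · exact (key i j h1 hij).elim
  · exact h1
  · exact (key j i h1 hij.symm).elim

theorem eval_gauge_pos {x : Fin N → ℝ} (hx : x ∈ posOrthant N)
    (hinj : Function.Injective x) : 0 < MvPolynomial.eval x (gauge N) := by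
  rw [eval_gauge_eq_exp hx hinj]
  exact Real.exp_pos _

theorem X_sub_X_dvd_gauge {i j : Fin N} (hij : i ≠ j) :
    (MvPolynomial.X i - MvPolynomial.X j : MvPolynomial (Fin N) ℝ) ∣ gauge N := by
  have key : ∀ i j : Fin N, i < j →
      (MvPolynomial.X j - MvPolynomial.X i : MvPolynomial (Fin N) ℝ) ∣ gauge N := by
    intro i j h
    refine Dvd.dvd.mul_left ?_ _
    exact (dvd_pow_self _ two_ne_zero).trans ((Finset.dvd_prod_of_mem
      (fun j => (MvPolynomial.X j - MvPolynomial.X i : MvPolynomial (Fin N) ℝ) ^ 2)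
      (Finset.mem_Ioi.2 h)).trans
      (Finset.dvd_prod_of_mem (fun i => ∏ j ∈ Finset.Ioi i,
        (MvPolynomial.X j - MvPolynomial.X i : MvPolynomial (Fin N) ℝ) ^ 2) (Finset.mem_univ i)))
  rcases lt_or_gt_of_ne hij with h | h
  · rw [← neg_sub, neg_dvd]; exact key i j h
  · exact key j i h

/-- A bounded function of the rescaled gauge which vanishes near the zero set of the gauge
compensates the pole of `1 / (x_i - x_j)`. -/
theorem subexponential_cutoff_div {η : ℝ → ℝ} {K : ℝ} (hη : ∀ s, |η s| ≤ K)
    (hη0 : ∀ s ≤ 1, η s = 0) (n : ℝ) (i j : Fin N) :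
    Subexponential (fun x => η (n * MvPolynomial.eval x (gauge N)) / (x i - x j)) := by
  by_cases hij : i = j
  · subst hij
    simpa using Subexponential.const 0
  obtain ⟨T, hT⟩ := X_sub_X_dvd_gauge hij
  have hK : 0 ≤ K := (abs_nonneg _).trans (hη 0)
  refine ((Subexponential.const (K * n)).mul (Subexponential.eval T)).mono fun x _ => ?_
  by_cases hs : n * MvPolynomial.eval x (gauge N) ≤ 1
  · rw [hη0 _ hs, zero_div, abs_zero]; exact abs_nonneg _
  have hG : MvPolynomial.eval x (gauge N) = (x i - x j) * MvPolynomial.eval x T := by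
    rw [hT]; simp
  push Not at hs
  have hne : x i - x j ≠ 0 := by
    intro h0
    rw [hG, h0] at hs
    simp at hs
    linarith
  rw [abs_div, div_le_iff₀ (abs_pos.2 hne)]
  calc |η (n * MvPolynomial.eval x (gauge N))| ≤ K * 1 := by rw [mul_one]; exact hη _
    _ ≤ K * |n * MvPolynomial.eval x (gauge N)| :=
        mul_le_mul_of_nonneg_left (hs.le.trans (le_abs_self _)) hK
    _ = |K * n * MvPolynomial.eval x T| * |x i - x j| := by
        rw [hG, ← abs_mul, ← abs_of_nonneg hK, ← abs_mul]
        rw [abs_of_nonneg hK]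
        congr 1; ring

end LaguerreEnsemble

/-! ### Integration by parts -/

namespace LaguerreEnsemble

open MeasureTheory Filter Topology MvPolynomial LaguerreAlgebra

variable {N : ℕ} {M β : ℝ}

/-- The singular part `∑_{j ≠ i} x_i ∂_i p / (x_i - x_j)` of the drift in direction `i`; the term
`j = i` is `0` because division by zero yields `0`. -/
noncomputable def singularDrift (p : MvPolynomial (Fin N) ℝ) (i : Fin N) (x : Fin N → ℝ) : ℝ :=
  ∑ j, x i * eval x (pderiv i p) / (x i - x j)

theorem measurable_singularDrift (p : MvPolynomial (Fin N) ℝ) (i : Fin N) :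
    Measurable (singularDrift p i) :=
  Finset.measurable_fun_sum _ fun j _ => ((measurable_pi_apply i).mul (measurable_eval _)).div
    ((measurable_pi_apply i).sub (measurable_pi_apply j))

/-- The singular parts of the drift add up to a polynomial when `p` is symmetric. -/
theorem sum_singularDrift {p : MvPolynomial (Fin N) ℝ} (hp : p.IsSymmetric) {x : Fin N → ℝ}
    (hinj : Function.Injective x) :
    ∑ i, singularDrift p i x = eval x (∑ i, ∑ j, dividedDiff p i j) / 2 := by
  have h : ∀ i j, eval x (dividedDiff p i j) =
      x i * eval x (pderiv i p) / (x i - x j) + x j * eval x (pderiv j p) / (x j - x i) := by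
    intro i j
    by_cases hij : i = j
    · subst hij; simp [dividedDiff_self]
    · have h1 := congrArg (eval x) (X_sub_X_mul_dividedDiff hp hij)
      have h2 : x i - x j ≠ 0 := sub_ne_zero.2 (hinj.ne hij)
      have h3 : x j - x i ≠ 0 := sub_ne_zero.2 (hinj.ne (Ne.symm hij))
      simp only [map_mul, map_sub, eval_X] at h1
      rw [eq_div_of_mul_eq h2 ((mul_comm _ _).trans h1), ← neg_sub (x i) (x j), div_neg]
      ring
  simp only [map_sum, h, Finset.sum_add_distrib]
  rw [Finset.sum_comm (f := fun i j => x j * eval x (pderiv j p) / (x j - x i))]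
  simp only [singularDrift]
  ring

/-- The vector field `x_i ∂_i p` times the density, cut off near the zero set of the gauge and
extended by zero outside of the orthant. -/
noncomputable def cutoffFlux (M β : ℝ) (χ : ℝ → ℝ) (n : ℝ) (p : MvPolynomial (Fin N) ℝ)
    (i : Fin N) : (Fin N → ℝ) → ℝ :=
  (posOrthant N).indicator fun x => laguerreWeight N M β x *
    (χ (n * eval x (gauge N)) * (x i * eval x (pderiv i p)))

/-- The ratio of the derivative of `cutoffFlux` in direction `i` to the density. -/
noncomputable def cutoffDivergence (M β : ℝ) (χ χ' : ℝ → ℝ) (n : ℝ) (p : MvPolynomial (Fin N) ℝ)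
    (i : Fin N) (x : Fin N → ℝ) : ℝ :=
  χ (n * eval x (gauge N)) * (x i * eval x (pderiv i (pderiv i p)) +
    β / 2 * (M - N + 1) * eval x (pderiv i p) - β * M / 2 * (x i * eval x (pderiv i p)) +
    β * singularDrift p i x) +
  n * eval x (gauge N) * χ' (n * eval x (gauge N)) *
    (eval x (pderiv i p) + 2 * singularDrift p i x)

theorem hasLineDerivAt_cutoffFlux {χ χ' : ℝ → ℝ} (hχ : ∀ s, HasDerivAt χ (χ' s) s)
    (h0 : ∀ s ≤ 1, χ s = 0 ∧ χ' s = 0) (n : ℝ) (p : MvPolynomial (Fin N) ℝ) (i : Fin N)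
    (x : Fin N → ℝ) :
    HasLineDerivAt ℝ (cutoffFlux M β χ n p i)
      ((posOrthant N).indicator
        (fun x => laguerreWeight N M β x * cutoffDivergence M β χ χ' n p i x) x) x
      (Pi.single i 1) := by
  by_cases hG : eval x (gauge N) = 0
  · -- near a zero of the gauge the cutoff vanishes
    have h1 : (posOrthant N).indicator
        (fun x => laguerreWeight N M β x * cutoffDivergence M β χ χ' n p i x) x = 0 := by
      rw [Set.indicator_apply_eq_zero]
      intro _
      simp [cutoffDivergence, hG, h0 0 zero_le_one]
    have h2 : cutoffFlux M β χ n p i =ᶠ[𝓝 x] fun _ => 0 := by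
      have hc : ContinuousAt (fun y => n * eval y (gauge N)) x :=
        (continuous_const.mul (MvPolynomial.continuous_eval _)).continuousAt
      filter_upwards [hc.eventually_lt (continuousAt_const (y := (1 : ℝ)))
        (by simp [hG])] with y hy
      rw [cutoffFlux, Set.indicator_apply_eq_zero]
      intro _
      simp [(h0 _ (le_of_lt hy)).1]
    rw [h1]
    exact (h2.hasLineDerivAt_iff).2 (hasDerivAt_const _ _)
  have hinj := injective_of_eval_gauge_ne_zero hG
  by_cases hx : x ∈ posOrthant N
  · rw [Set.indicator_of_mem hx]
    have hO1 : ∀ᶠ y in 𝓝 x, y ∈ posOrthant N := isOpen_posOrthant.mem_nhds hx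
    have hO2 : ∀ᶠ y in 𝓝 x, eval y (gauge N) ≠ 0 :=
      (MvPolynomial.continuous_eval _).continuousAt.eventually_ne hG
    have hev : cutoffFlux M β χ n p i =ᶠ[𝓝 x] fun y =>
        Real.exp (logWeight (β / 2 * (M - N + 1) - 1) β (β * M / 2) y) *
          (χ (n * Real.exp (logWeight 1 2 0 y)) * (y i * eval y (pderiv i p))) := by
      filter_upwards [hO1, hO2] with y hy1 hy2
      have hyi := injective_of_eval_gauge_ne_zero hy2
      rw [cutoffFlux, Set.indicator_of_mem (s := posOrthant N) hy1,
        laguerreWeight_eq_exp hy1 hyi, eval_gauge_eq_exp hy1 hyi]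
    rw [hev.hasLineDerivAt_iff]
    set v : Fin N → ℝ := Pi.single i 1
    have hx0 : x + (0 : ℝ) • v = x := by simp
    have d1 : HasDerivAt
        (fun t : ℝ => logWeight (β / 2 * (M - N + 1) - 1) β (β * M / 2) (x + t • v))
        ((β / 2 * (M - N + 1) - 1) / x i - β * M / 2 + β * ∑ j, 1 / (x i - x j)) 0 :=
      hasLineDerivAt_logWeight (β / 2 * (M - N + 1) - 1) β (β * M / 2) hx hinj i
    have d2 : HasDerivAt (fun t : ℝ => logWeight 1 2 0 (x + t • v))
        (1 / x i - 0 + 2 * ∑ j, 1 / (x i - x j)) 0 :=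
      hasLineDerivAt_logWeight 1 2 0 hx hinj i
    have d3 : HasDerivAt (fun t : ℝ => eval (x + t • v) (X i * pderiv i p))
        (eval x (pderiv i (X i * pderiv i p))) 0 := hasLineDerivAt_eval (X i * pderiv i p) x i
    have d4 : HasDerivAt (fun t : ℝ => χ (n * Real.exp (logWeight 1 2 0 (x + t • v))))
        (χ' (n * Real.exp (logWeight 1 2 0 x)) * (n * (Real.exp (logWeight 1 2 0 x) *
          (1 / x i - 0 + 2 * ∑ j, 1 / (x i - x j))))) 0 := by
      have e := d2.exp.const_mul n
      rw [hx0] at e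
      refine HasDerivAt.comp (h₂ := χ)
        (h := fun t : ℝ => n * Real.exp (logWeight 1 2 0 (x + t • v))) 0 ?_ e
      rw [hx0]
      exact hχ _
    have d5 := d1.exp.fun_mul (d4.fun_mul d3)
    rw [hx0] at d5
    have : ∀ y : Fin N → ℝ, y i * eval y (pderiv i p) = eval y (X i * pderiv i p) := by simp
    simp only [this]
    rw [HasLineDerivAt]
    refine HasDerivAt.congr_deriv d5 ?_
    rw [← laguerreWeight_eq_exp hx hinj, ← eval_gauge_eq_exp hx hinj, cutoffDivergence]
    have hs : singularDrift p i x =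
        x i * eval x (pderiv i p) * ∑ j, 1 / (x i - x j) := by
      rw [singularDrift, Finset.mul_sum]
      exact Finset.sum_congr rfl fun j _ => by rw [mul_one_div]
    have hxi : x i ≠ 0 := (hx i).ne'
    rw [hs]
    simp only [pderiv_mul, pderiv_X_self, map_add, map_mul, eval_X, one_mul]
    field_simp
    ring
  · rw [Set.indicator_of_notMem hx]
    have hxk : ∃ k, x k < 0 := by
      by_contra hcon
      push Not at hcon
      apply hx
      intro k
      refine lt_of_le_of_ne (hcon k) fun hk => hG ?_
      rw [eval_gauge, Finset.prod_eq_zero (Finset.mem_univ k) hk.symm, zero_mul]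
    obtain ⟨k, hk⟩ := hxk
    have h2 : cutoffFlux M β χ n p i =ᶠ[𝓝 x] fun _ => 0 := by
      filter_upwards [(continuous_apply k).continuousAt.eventually_lt
        (continuousAt_const (y := (0 : ℝ))) hk] with y hy
      rw [cutoffFlux, Set.indicator_of_notMem]
      exact fun h => absurd (h k) (not_lt.2 hy.le)
    exact (h2.hasLineDerivAt_iff).2 (hasDerivAt_const _ _)

/-- Integration by parts in one coordinate, away from the zero set of the gauge. -/
theorem integral_mul_cutoffDivergence (hN : 1 ≤ N) (hβ : 0 < β) (hM : (N : ℝ) - 1 < M)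
    {χ χ' : ℝ → ℝ} {K : ℝ} (hχ : ∀ s, HasDerivAt χ (χ' s) s) (hχ' : Continuous χ')
    (hb : ∀ s, |χ s| ≤ 1) (h0 : ∀ s ≤ 1, χ s = 0 ∧ χ' s = 0) (hK : ∀ s, |s * χ' s| ≤ K)
    (n : ℝ) (p q : MvPolynomial (Fin N) ℝ) (i : Fin N) :
    Integrable (fun x => eval x q * cutoffDivergence M β χ χ' n p i x)
      (laguerreUnnormalized N M β) ∧
    Integrable (fun x => χ (n * eval x (gauge N)) *
      (x i * eval x (pderiv i p) * eval x (pderiv i q))) (laguerreUnnormalized N M β) ∧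
    ∫ x, eval x q * cutoffDivergence M β χ χ' n p i x ∂(laguerreUnnormalized N M β) =
      -∫ x, χ (n * eval x (gauge N)) *
        (x i * eval x (pderiv i p) * eval x (pderiv i q)) ∂(laguerreUnnormalized N M β) := by
  have hχc : Continuous χ := continuous_iff_continuousAt.2 fun s => (hχ s).continuousAt
  have mG : Measurable fun x : Fin N → ℝ => n * eval x (gauge N) :=
    measurable_const.mul (measurable_eval _)
  have mχ : Measurable fun x : Fin N → ℝ => χ (n * eval x (gauge N)) := hχc.measurable.comp mG
  have mη : Measurable fun x : Fin N → ℝ =>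
      n * eval x (gauge N) * χ' (n * eval x (gauge N)) := mG.mul (hχ'.measurable.comp mG)
  have sχ : Subexponential fun x : Fin N → ℝ => χ (n * eval x (gauge N)) :=
    (Subexponential.const 1).mono fun x _ => by simpa using hb _
  have sη : Subexponential fun x : Fin N → ℝ =>
      n * eval x (gauge N) * χ' (n * eval x (gauge N)) :=
    (Subexponential.const K).mono fun x _ => (hK _).trans (le_abs_self K)
  have sDrift : ∀ (η : ℝ → ℝ) (L : ℝ), (∀ s, |η s| ≤ L) → (∀ s ≤ 1, η s = 0) →
      Subexponential fun x => η (n * eval x (gauge N)) * singularDrift p i x := by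
    intro η L hη hη0
    have h1 : ∀ s : Finset (Fin N), Subexponential fun x : Fin N → ℝ => ∑ j ∈ s,
        x i * eval x (pderiv i p) * (η (n * eval x (gauge N)) / (x i - x j)) := by
      intro s
      induction s using Finset.induction_on with
      | empty => simpa using Subexponential.const (N := N) 0
      | insert j s hj ih =>
        simp only [Finset.sum_insert hj]
        exact (((Subexponential.coord i).mul (Subexponential.eval _)).mul
          (subexponential_cutoff_div hη hη0 n i j)).add ih
    refine (h1 Finset.univ).mono fun x _ => le_of_eq ?_
    rw [singularDrift, Finset.mul_sum]
    congr 1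
    exact Finset.sum_congr rfl fun j _ => by ring
  have sDiv : Subexponential (cutoffDivergence M β χ χ' n p i) := by
    have e1 := (sχ.mul (Subexponential.eval (X i * pderiv i (pderiv i p) +
      C (β / 2 * (M - N + 1)) * pderiv i p - C (β * M / 2) * (X i * pderiv i p)))).add
      ((Subexponential.const β).mul (sDrift χ 1 hb fun s hs => (h0 s hs).1))
    have e2 := (sη.mul (Subexponential.eval (pderiv i p))).add
      ((Subexponential.const 2).mul (sDrift (fun s => s * χ' s) K hK
        fun s hs => by rw [(h0 s hs).2, mul_zero]))
    refine (e1.add e2).mono fun x _ => le_of_eq ?_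
    simp only [cutoffDivergence, map_add, map_sub, map_mul, eval_X, eval_C]
    congr 1; ring
  have mDiv : Measurable (cutoffDivergence M β χ χ' n p i) :=
    (mχ.mul ((((measurable_pi_apply i).mul (measurable_eval _)).add
      (measurable_const.mul (measurable_eval _))).sub (measurable_const.mul
        ((measurable_pi_apply i).mul (measurable_eval _))) |>.add
      (measurable_const.mul (measurable_singularDrift p i)))).add
    (mη.mul ((measurable_eval _).add (measurable_const.mul (measurable_singularDrift p i))))
  have i1 : Integrable (fun x => eval x q * cutoffDivergence M β χ χ' n p i x)
      (laguerreUnnormalized N M β) :=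
    ((Subexponential.eval q).mul sDiv).integrable hN hβ hM ((measurable_eval q).mul mDiv)
  have i2 : ∀ r : MvPolynomial (Fin N) ℝ, Integrable (fun x => χ (n * eval x (gauge N)) *
      (x i * eval x (pderiv i p) * eval x r)) (laguerreUnnormalized N M β) := fun r =>
    (sχ.mul (((Subexponential.coord i).mul (Subexponential.eval _)).mul
      (Subexponential.eval r))).integrable hN hβ hM
      (mχ.mul (((measurable_pi_apply i).mul (measurable_eval _)).mul (measurable_eval r)))
  refine ⟨i1, i2 _, ?_⟩
  have f1 : (fun x => eval x q * (posOrthant N).indicator (fun x => laguerreWeight N M β x *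
      cutoffDivergence M β χ χ' n p i x) x) = (posOrthant N).indicator (fun x =>
      laguerreWeight N M β x * (eval x q * cutoffDivergence M β χ χ' n p i x)) := by
    ext x
    rw [Set.indicator_apply, Set.indicator_apply]
    split_ifs <;> ring
  have f2 : ∀ r : MvPolynomial (Fin N) ℝ, (fun x => eval x r * cutoffFlux M β χ n p i x) =
      (posOrthant N).indicator (fun x => laguerreWeight N M β x *
        (χ (n * eval x (gauge N)) * (x i * eval x (pderiv i p) * eval x r))) := by
    intro r
    ext x
    rw [cutoffFlux, Set.indicator_apply, Set.indicator_apply]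
    split_ifs <;> ring
  have j1 := (integrable_indicator_iff measurableSet_posOrthant).2
    (integrable_laguerreUnnormalized_iff.1 i1)
  have j2 := fun r => (integrable_indicator_iff measurableSet_posOrthant).2
    (integrable_laguerreUnnormalized_iff.1 (i2 r))
  rw [← f1] at j1
  simp only [← f2] at j2
  have main := integral_bilinear_hasLineDerivAt_right_eq_neg_left_of_integrable
    (μ := (volume : Measure (Fin N → ℝ))) (B := ContinuousLinearMap.mul ℝ ℝ)
    (f := fun x => eval x q) (f' := fun x => eval x (pderiv i q))
    (g := cutoffFlux M β χ n p i) (v := Pi.single i 1)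
    (g' := (posOrthant N).indicator
        (fun x => laguerreWeight N M β x * cutoffDivergence M β χ χ' n p i x))
    (j2 _) j1 (j2 _) (fun x _ => hasLineDerivAt_eval q x i)
    (fun x _ => hasLineDerivAt_cutoffFlux hχ h0 n p i x)
  simp only [ContinuousLinearMap.mul_apply'] at main
  rw [f1, f2, integral_indicator measurableSet_posOrthant,
    integral_indicator measurableSet_posOrthant, ← integral_laguerreUnnormalized,
    ← integral_laguerreUnnormalized] at main
  exact main

/-- The generator of the Laguerre diffusion with the parameters of the ensemble. -/
noncomputable abbrev laguerreGenerator (M β : ℝ) (p : MvPolynomial (Fin N) ℝ) :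
    MvPolynomial (Fin N) ℝ :=
  generator (β / 2 * (M - N + 1)) (β * M / 2) β p

/-- The polynomial `∑ x_i ∂_i p ∂_i q`. -/
noncomputable def carreDuChamp (p q : MvPolynomial (Fin N) ℝ) : MvPolynomial (Fin N) ℝ :=
  ∑ i, X i * pderiv i p * pderiv i q

/-- The Laguerre ensemble is the symmetrizing measure of the Laguerre diffusion. -/
theorem integral_mul_laguerreGenerator (hN : 1 ≤ N) (hβ : 0 < β) (hM : (N : ℝ) - 1 < M)
    {p : MvPolynomial (Fin N) ℝ} (hp : p.IsSymmetric) (q : MvPolynomial (Fin N) ℝ) :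
    ∫ x, eval x (q * laguerreGenerator M β p) ∂(laguerreUnnormalized N M β) =
      -∫ x, eval x (carreDuChamp p q) ∂(laguerreUnnormalized N M β) := by
  obtain ⟨χ, χ', hχ, hχ', hb, h0, h1, K, hK⟩ := exists_cutoff
  have hχc : Continuous χ := continuous_iff_continuousAt.2 fun s => (hχ s).continuousAt
  have hK0 : 0 ≤ K := (abs_nonneg _).trans (hK 0)
  set κ : MvPolynomial (Fin N) ℝ := ∑ i, pderiv i p + ∑ i, ∑ j, dividedDiff p i j with hκ
  have hμ : ∀ᵐ x ∂(laguerreUnnormalized N M β), x ∈ posOrthant N ∧ Function.Injective x :=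
    ae_mem_posOrthant.and ((withDensity_absolutelyContinuous _ _).ae_le
      (ae_restrict_of_ae ae_injective))
  have mG : ∀ n : ℕ, Measurable fun x : Fin N → ℝ => (n : ℝ) * eval x (gauge N) := fun n =>
    measurable_const.mul (measurable_eval _)
  -- the identity for the cut off vector field, summed over the coordinates
  have key : ∀ n : ℕ,
      ∫ x, (χ (n * eval x (gauge N)) * eval x (q * laguerreGenerator M β p) +
        n * eval x (gauge N) * χ' (n * eval x (gauge N)) * eval x (q * κ))
        ∂(laguerreUnnormalized N M β) =
      -∫ x, χ (n * eval x (gauge N)) * eval x (carreDuChamp p q)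
        ∂(laguerreUnnormalized N M β) := by
    intro n
    have h := fun i => integral_mul_cutoffDivergence hN hβ hM hχ hχ' hb h0 hK n p q i
    have hsum : ∑ i, ∫ x, eval x q * cutoffDivergence M β χ χ' n p i x
          ∂(laguerreUnnormalized N M β) =
        -∑ i, ∫ x, χ (n * eval x (gauge N)) *
          (x i * eval x (pderiv i p) * eval x (pderiv i q)) ∂(laguerreUnnormalized N M β) := by
      rw [← Finset.sum_neg_distrib]
      exact Finset.sum_congr rfl fun i _ => (h i).2.2
    rw [← integral_finsetSum _ fun i _ => (h i).1,
      ← integral_finsetSum _ fun i _ => (h i).2.1] at hsum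
    calc _ = _ := integral_congr_ae ?_
      _ = _ := hsum
      _ = _ := by
        congr 1
        refine integral_congr_ae (Eventually.of_forall fun x => ?_)
        simp [carreDuChamp, Finset.mul_sum]
    filter_upwards [hμ] with x hx
    have hs := sum_singularDrift hp hx.2
    rw [← Finset.mul_sum]
    have : ∑ i, cutoffDivergence M β χ χ' n p i x =
        χ (n * eval x (gauge N)) * eval x (laguerreGenerator M β p) +
        n * eval x (gauge N) * χ' (n * eval x (gauge N)) * eval x κ := by
      simp only [cutoffDivergence, Finset.sum_add_distrib, ← Finset.mul_sum,
        Finset.sum_sub_distrib, hs, laguerreGenerator, generator, hκ, map_add, map_sub, map_mul,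
        map_sum, eval_C, eval_X]
      ring
    rw [this, map_mul, map_mul]
    ring
  -- the cutoff tends to `1`, and its derivative to `0`, off the zero set of the gauge
  have hlarge : ∀ x : Fin N → ℝ, x ∈ posOrthant N ∧ Function.Injective x →
      ∀ᶠ n : ℕ in atTop, 2 < (n : ℝ) * eval x (gauge N) := fun x hx =>
    (tendsto_natCast_atTop_atTop.atTop_mul_const (eval_gauge_pos hx.1 hx.2)).eventually_gt_atTop 2
  have iAbs : ∀ r : MvPolynomial (Fin N) ℝ,
      Integrable (fun x => |eval x r|) (laguerreUnnormalized N M β) := fun r =>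
    ((Subexponential.eval r).integrable hN hβ hM (measurable_eval r)).abs
  have mχ : ∀ n : ℕ, Measurable fun x : Fin N → ℝ => χ ((n : ℝ) * eval x (gauge N)) :=
    fun n => hχc.measurable.comp (mG n)
  have lim1 : Tendsto (fun n : ℕ =>
      ∫ x, (χ (n * eval x (gauge N)) * eval x (q * laguerreGenerator M β p) +
        n * eval x (gauge N) * χ' (n * eval x (gauge N)) * eval x (q * κ))
        ∂(laguerreUnnormalized N M β)) atTop
      (𝓝 (∫ x, eval x (q * laguerreGenerator M β p) ∂(laguerreUnnormalized N M β))) := by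
    refine tendsto_integral_of_dominated_convergence
      (fun x => |eval x (q * laguerreGenerator M β p)| + K * |eval x (q * κ)|)
      (fun n => (((mχ n).mul (measurable_eval _)).add (((mG n).mul
        (hχ'.measurable.comp (mG n))).mul (measurable_eval _))).aestronglyMeasurable)
      ((iAbs _).add ((iAbs _).const_mul K)) (fun n => Eventually.of_forall fun x => ?_) ?_
    · rw [Real.norm_eq_abs]
      refine (abs_add_le _ _).trans (add_le_add ?_ ?_)
      · rw [abs_mul]
        exact mul_le_of_le_one_left (abs_nonneg _) (hb _)
      · rw [abs_mul]
        exact mul_le_mul_of_nonneg_right (hK _) (abs_nonneg _)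
    · filter_upwards [hμ] with x hx
      refine tendsto_const_nhds.congr' ?_
      filter_upwards [hlarge x hx] with n hn
      rw [(h1 _ hn).1, (h1 _ hn).2]
      ring
  have lim2 : Tendsto (fun n : ℕ => ∫ x, χ (n * eval x (gauge N)) * eval x (carreDuChamp p q)
        ∂(laguerreUnnormalized N M β)) atTop
      (𝓝 (∫ x, eval x (carreDuChamp p q) ∂(laguerreUnnormalized N M β))) := by
    refine tendsto_integral_of_dominated_convergence (fun x => |eval x (carreDuChamp p q)|)
      (fun n => ((mχ n).mul (measurable_eval _)).aestronglyMeasurable)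
      (iAbs _) (fun n => Eventually.of_forall fun x => ?_) ?_
    · rw [Real.norm_eq_abs, abs_mul]
      exact mul_le_of_le_one_left (abs_nonneg _) (hb _)
    · filter_upwards [hμ] with x hx
      refine tendsto_const_nhds.congr' ?_
      filter_upwards [hlarge x hx] with n hn
      rw [(h1 _ hn).1, one_mul]
  refine tendsto_nhds_unique lim1 ?_
  simp only [key]
  exact lim2.neg

end LaguerreEnsemble

/-! ### Spectral gap on symmetric polynomials -/

namespace LaguerreEnsemble

open MeasureTheory Filter Topology MvPolynomial LaguerreAlgebra

variable {N : ℕ} {M β : ℝ}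

theorem Subexponential.integrable_betaLaguerre (hN : 1 ≤ N) (hβ : 0 < β) (hM : (N : ℝ) - 1 < M)
    {φ : (Fin N → ℝ) → ℝ} (hφ : Measurable φ) (h : Subexponential φ) :
    Integrable φ (betaLaguerre N M β) :=
  (h.integrable hN hβ hM hφ).smul_measure (ENNReal.inv_ne_top.2 laguerreZ_ne_zero)

theorem integrable_eval (hN : 1 ≤ N) (hβ : 0 < β) (hM : (N : ℝ) - 1 < M)
    (p : MvPolynomial (Fin N) ℝ) : Integrable (fun x => eval x p) (betaLaguerre N M β) :=
  (Subexponential.eval p).integrable_betaLaguerre hN hβ hM (measurable_eval p)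

theorem memLp_eval (hN : 1 ≤ N) (hβ : 0 < β) (hM : (N : ℝ) - 1 < M)
    (p : MvPolynomial (Fin N) ℝ) : MemLp (fun x => eval x p) 2 (betaLaguerre N M β) := by
  rw [memLp_two_iff_integrable_sq (measurable_eval p).aestronglyMeasurable]
  have h := integrable_eval hN hβ hM (p ^ 2)
  simp only [map_pow] at h
  exact h

/-- The expectation of a polynomial in the particles. -/
noncomputable def expect (M β : ℝ) (p : MvPolynomial (Fin N) ℝ) : ℝ :=
  ∫ x, eval x p ∂(betaLaguerre N M β)

theorem expect_add (hN : 1 ≤ N) (hβ : 0 < β) (hM : (N : ℝ) - 1 < M)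
    (p q : MvPolynomial (Fin N) ℝ) :
    expect M β (p + q) = expect M β p + expect M β q := by
  simp only [expect, map_add]
  exact integral_add (integrable_eval hN hβ hM p) (integrable_eval hN hβ hM q)

theorem expect_C_mul (c : ℝ) (p : MvPolynomial (Fin N) ℝ) :
    expect M β (C c * p) = c * expect M β p := by
  simp only [expect, map_mul, eval_C]
  exact integral_const_mul _ _

theorem expect_C (hN : 1 ≤ N) (hβ : 0 < β) (hM : (N : ℝ) - 1 < M) (c : ℝ) :
    expect M β (C c : MvPolynomial (Fin N) ℝ) = c := by
  have := isProbabilityMeasure_betaLaguerre hN hβ hM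
  simp [expect]

theorem expect_sq_nonneg (p : MvPolynomial (Fin N) ℝ) : 0 ≤ expect M β (p * p) := by
  simp only [expect, map_mul]
  exact integral_nonneg fun x => mul_self_nonneg _

theorem expect_mul_laguerreGenerator (hN : 1 ≤ N) (hβ : 0 < β) (hM : (N : ℝ) - 1 < M)
    {p : MvPolynomial (Fin N) ℝ} (hp : p.IsSymmetric) (q : MvPolynomial (Fin N) ℝ) :
    expect M β (q * laguerreGenerator M β p) = -expect M β (carreDuChamp p q) := by
  rw [expect, expect, betaLaguerre, integral_smul_measure, integral_smul_measure,
    integral_mul_laguerreGenerator hN hβ hM hp, smul_neg]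

/-- Orthogonal projection in `L²` onto a finite-dimensional space of polynomials. -/
theorem exists_orthogonal_projection (hN : 1 ≤ N) (hβ : 0 < β) (hM : (N : ℝ) - 1 < M)
    (W : Submodule ℝ (MvPolynomial (Fin N) ℝ)) [Module.Finite ℝ W]
    (p : MvPolynomial (Fin N) ℝ) : ∃ q ∈ W, ∀ r ∈ W, expect M β ((p - q) * r) = 0 := by
  let T : MvPolynomial (Fin N) ℝ →ₗ[ℝ] Lp ℝ 2 (betaLaguerre N M β) :=
    { toFun := fun p => (memLp_eval hN hβ hM p).toLp _
      map_add' := fun p q => by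
        rw [← MemLp.toLp_add]
        congr 1
        ext x; simp
      map_smul' := fun c p => by
        rw [RingHom.id_apply, ← MemLp.toLp_const_smul]
        congr 1
        ext x; simp [smul_eval] }
  have hT : ∀ p q, inner ℝ (T p) (T q) = expect M β (p * q) := fun p q => by
    rw [L2.inner_def]
    refine integral_congr_ae ?_
    filter_upwards [(memLp_eval hN hβ hM p).coeFn_toLp, (memLp_eval hN hβ hM q).coeFn_toLp]
      with x h1 h2
    change inner ℝ ((memLp_eval hN hβ hM p).toLp _ x) ((memLp_eval hN hβ hM q).toLp _ x) = _
    rw [h1, h2]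
    simp [mul_comm]
  obtain ⟨y, hy, z, hz, hyz⟩ := (W.map T).exists_add_mem_mem_orthogonal (T p)
  obtain ⟨q, hq, rfl⟩ := Submodule.mem_map.1 hy
  refine ⟨q, hq, fun r hr => ?_⟩
  have hz' : z = T (p - q) := by rw [map_sub, hyz]; simp
  rw [← hT, ← hz', real_inner_comm]
  exact (Submodule.mem_orthogonal _ _).1 hz _ (Submodule.mem_map_of_mem hr)

theorem carreDuChamp_add_self (p q : MvPolynomial (Fin N) ℝ) :
    carreDuChamp (p + q) (p + q) =
      carreDuChamp p p + C 2 * carreDuChamp p q + carreDuChamp q q := by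
  simp only [carreDuChamp, Finset.mul_sum, ← Finset.sum_add_distrib, map_add]
  refine Finset.sum_congr rfl fun i _ => ?_
  rw [show (C 2 : MvPolynomial (Fin N) ℝ) = 2 from map_ofNat C 2]
  ring

/-- The spectral gap on symmetric polynomials, with the sharp constant. The generator is
self-adjoint and triangular for the degree filtration, so it acts on the orthogonal complement of
degree `k` in degree `k + 1` with eigenvalue `-(k + 1) β M / 2`; the first gap is the smallest. -/
theorem poincare_of_mem_symmDegreeLE (hN : 1 ≤ N) (hβ : 0 < β) (hM : (N : ℝ) - 1 < M) (k : ℕ) :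
    ∀ p ∈ symmDegreeLE (Fin N) k,
      β * M / 2 * (expect M β (p * p) - expect M β p ^ 2) ≤ expect M β (carreDuChamp p p) := by
  have hb := rate_pos hN hβ hM
  induction k with
  | zero =>
    intro p hp
    obtain ⟨c, rfl⟩ : ∃ c, p = C c :=
      ⟨_, totalDegree_eq_zero_iff_eq_C.1 (Nat.le_zero.1 (mem_symmDegreeLE.1 hp).2)⟩
    have h0 : carreDuChamp (C c) (C c : MvPolynomial (Fin N) ℝ) = C 0 := by simp [carreDuChamp]
    rw [h0, ← C_mul, expect_C hN hβ hM, expect_C hN hβ hM, expect_C hN hβ hM]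
    apply le_of_eq
    ring
  | succ k ih =>
    intro p hp
    obtain ⟨q, hq, horth⟩ := exists_orthogonal_projection hN hβ hM (symmDegreeLE (Fin N) k) p
    obtain ⟨r, rfl⟩ : ∃ r, p = q + r := ⟨p - q, by ring⟩
    have hq1 : q ∈ symmDegreeLE (Fin N) (k + 1) := symmDegreeLE_mono k.le_succ hq
    have hr : r ∈ symmDegreeLE (Fin N) (k + 1) := by
      simpa using Submodule.sub_mem _ hp hq1
    simp only [add_sub_cancel_left] at horth
    have hr0 : expect M β r = 0 := by
      have := horth 1 (mem_symmDegreeLE.2 ⟨IsSymmetric.one, by simp⟩)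
      rwa [mul_one] at this
    have hsq : expect M β ((q + r) * (q + r)) = expect M β (q * q) + expect M β (r * r) := by
      have : (q + r) * (q + r) = q * q + C 2 * (r * q) + r * r := by
        rw [show (C 2 : MvPolynomial (Fin N) ℝ) = 2 from map_ofNat C 2]
        ring
      rw [this, expect_add hN hβ hM, expect_add hN hβ hM, expect_C_mul, horth q hq]
      ring
    have hgen : ∀ s ∈ symmDegreeLE (Fin N) (k + 1), expect M β (r * laguerreGenerator M β s) =
        -(β * M / 2 * (k + 1)) * expect M β (r * s) := by
      intro s hs
      have h1 := generator_add_mem (β / 2 * (M - N + 1)) (β * M / 2) β hs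
      have h2 : r * laguerreGenerator M β s =
          r * (laguerreGenerator M β s + C (β * M / 2 * (k + 1)) * s) +
            C (-(β * M / 2 * (k + 1))) * (r * s) := by
        rw [C_neg]; ring
      rw [h2, expect_add hN hβ hM, expect_C_mul, horth _ h1, zero_add]
    have hcross : expect M β (carreDuChamp q r) = 0 := by
      have h1 := expect_mul_laguerreGenerator hN hβ hM (mem_symmDegreeLE.1 hq).1 r
      rw [hgen q hq1, horth q hq] at h1
      linarith
    have hdiag : expect M β (carreDuChamp r r) =
        β * M / 2 * (k + 1) * expect M β (r * r) := by
      have h1 := expect_mul_laguerreGenerator hN hβ hM (mem_symmDegreeLE.1 hr).1 r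
      rw [hgen r hr] at h1
      linarith
    rw [hsq, expect_add hN hβ hM, hr0, add_zero, carreDuChamp_add_self, expect_add hN hβ hM,
      expect_add hN hβ hM, expect_C_mul, hcross, hdiag]
    have h2 := ih q hq
    have h3 : 0 ≤ β * M / 2 * k * expect M β (r * r) :=
      mul_nonneg (mul_nonneg hb.le k.cast_nonneg) (expect_sq_nonneg r)
    linarith

end LaguerreEnsemble

/-! ### Weighted polynomial approximation on the half-line -/

namespace WeightedApproximation

open Polynomial

/-- `g` can be approximated on the half-line by polynomials uniformly with respect to the weight
`exp (-s x)`. -/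
def PolyApprox (s : ℝ) (g : ℝ → ℝ) : Prop :=
  ∀ ε : ℝ, 0 < ε → ∃ q : ℝ[X], ∀ x : ℝ, 0 ≤ x → |q.eval x - g x| ≤ ε * Real.exp (s * x)

theorem PolyApprox.add {s : ℝ} {g h : ℝ → ℝ} (hg : PolyApprox s g) (hh : PolyApprox s h) :
    PolyApprox s (fun x => g x + h x) := fun ε hε => by
  obtain ⟨p, hp⟩ := hg (ε / 2) (half_pos hε)
  obtain ⟨q, hq⟩ := hh (ε / 2) (half_pos hε)
  refine ⟨p + q, fun x hx => ?_⟩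
  rw [eval_add, add_sub_add_comm]
  refine (abs_add_le _ _).trans ((add_le_add (hp x hx) (hq x hx)).trans (le_of_eq ?_))
  ring

theorem PolyApprox.const_mul {s : ℝ} {g : ℝ → ℝ} (hg : PolyApprox s g) (c : ℝ) :
    PolyApprox s (fun x => c * g x) := fun ε hε => by
  have hc : 0 < |c| + 1 := by positivity
  obtain ⟨p, hp⟩ := hg (ε / (|c| + 1)) (div_pos hε hc)
  refine ⟨C c * p, fun x hx => ?_⟩
  rw [eval_mul, eval_C, ← mul_sub, abs_mul]
  calc |c| * |p.eval x - g x| ≤ (|c| + 1) * (ε / (|c| + 1) * Real.exp (s * x)) :=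
        mul_le_mul (by linarith) (hp x hx) (abs_nonneg _) hc.le
    _ = ε * Real.exp (s * x) := by field_simp

theorem exists_abs_eval_le_exp (q : ℝ[X]) {δ : ℝ} (hδ : 0 < δ) :
    ∃ C : ℝ, 0 ≤ C ∧ ∀ x : ℝ, 0 ≤ x → |q.eval x| ≤ C * Real.exp (δ * x) := by
  induction q using Polynomial.induction_on' with
  | add p q hp hq =>
    obtain ⟨C, hC, h1⟩ := hp
    obtain ⟨D, hD, h2⟩ := hq
    refine ⟨C + D, add_nonneg hC hD, fun x hx => ?_⟩
    rw [eval_add, add_mul]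
    exact (abs_add_le _ _).trans (add_le_add (h1 x hx) (h2 x hx))
  | monomial n a =>
    refine ⟨|a| * (n.factorial / δ ^ n), by positivity, fun x hx => ?_⟩
    rw [eval_monomial, abs_mul, abs_of_nonneg (pow_nonneg hx n), mul_assoc]
    refine mul_le_mul_of_nonneg_left ?_ (abs_nonneg a)
    have h := Real.pow_div_factorial_le_exp (δ * x) (by positivity) n
    rw [mul_pow, div_le_iff₀ (by positivity)] at h
    rw [div_mul_eq_mul_div, le_div_iff₀ (by positivity)]
    linarith

/-- The Taylor polynomials of `exp (-t x)` converge to it on the half-line with respect to the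
weight `exp (-δ x)` when `t < δ`. -/
theorem polyApprox_exp_neg {t δ : ℝ} (ht : 0 < t) (htδ : t < δ) :
    PolyApprox δ (fun x => Real.exp (-(t * x))) := fun ε hε => by
  have hδ : 0 < δ := ht.trans htδ
  have hρ : t / δ < 1 := (div_lt_one hδ).2 htδ
  obtain ⟨n, hn⟩ := exists_pow_lt_of_lt_one hε hρ
  refine ⟨∑ k ∈ Finset.range n, C ((-t) ^ k / k.factorial) * X ^ k, fun x hx => ?_⟩
  have e1 : (∑ k ∈ Finset.range n, C ((-t) ^ k / k.factorial) * X ^ k : ℝ[X]).eval x =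
      ∑ k ∈ Finset.range n, (-(t * x)) ^ k / k.factorial := by
    rw [eval_finsetSum]
    refine Finset.sum_congr rfl fun k _ => ?_
    simp only [eval_mul, eval_C, eval_pow, eval_X]
    rw [← neg_mul, mul_pow]
    ring
  have hs : ∀ y : ℝ, HasSum (fun k : ℕ => y ^ k / (k.factorial : ℝ)) (Real.exp y) := fun y => by
    rw [Real.exp_eq_exp_ℝ]
    exact NormedSpace.expSeries_div_hasSum_exp y
  have h1 := (hasSum_nat_add_iff' n).2 (hs (-(t * x)))
  have h2 := ((hasSum_nat_add_iff' n).2 (hs (δ * x))).mul_left ((t / δ) ^ n)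
  have h3 : 0 ≤ ∑ k ∈ Finset.range n, (δ * x) ^ k / (k.factorial : ℝ) :=
    Finset.sum_nonneg fun k _ => by positivity
  -- the tail of the series at `t x` is at most `(t / δ) ^ n` times the tail at `δ x`
  have h4 := h1.norm_le_of_bounded h2 fun k => by
    rw [Real.norm_eq_abs, abs_div, abs_pow, abs_neg, abs_of_nonneg (by positivity : 0 ≤ t * x),
      Nat.abs_cast, ← mul_div_assoc]
    refine div_le_div_of_nonneg_right ?_ (Nat.cast_nonneg _)
    have e2 : (t * x) ^ (k + n) = (t / δ) ^ (k + n) * (δ * x) ^ (k + n) := by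
      rw [← mul_pow]; congr 1; field_simp
    rw [e2]
    refine mul_le_mul_of_nonneg_right ?_ (by positivity)
    exact pow_le_pow_of_le_one (by positivity) hρ.le (Nat.le_add_left n k)
  rw [e1, abs_sub_comm, ← Real.norm_eq_abs]
  refine h4.trans (mul_le_mul hn.le (sub_le_self _ h3) ?_ hε.le)
  rw [sub_nonneg]
  exact Real.sum_le_exp_of_nonneg (by positivity) n

/-- The class of approximable functions is stable under multiplication by `exp (-s x / 4)`. -/
theorem PolyApprox.exp_mul {s : ℝ} (hs : 0 < s) {g : ℝ → ℝ} (hg : PolyApprox s g) :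
    PolyApprox s (fun x => Real.exp (-(s / 4 * x)) * g x) := fun ε hε => by
  obtain ⟨q, hq⟩ := hg (ε / 2) (half_pos hε)
  obtain ⟨D, hD, hqD⟩ := exists_abs_eval_le_exp q (half_pos hs)
  obtain ⟨T, hT⟩ := polyApprox_exp_neg (t := s / 4) (δ := s / 2) (by linarith) (by linarith)
    (ε / (2 * (D + 1))) (by positivity)
  refine ⟨T * q, fun x hx => ?_⟩
  have hsplit : (T * q).eval x - Real.exp (-(s / 4 * x)) * g x =
      (T.eval x - Real.exp (-(s / 4 * x))) * q.eval x +
        Real.exp (-(s / 4 * x)) * (q.eval x - g x) := by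
    rw [eval_mul]; ring
  have h1 : Real.exp (-(s / 4 * x)) ≤ 1 := Real.exp_le_one_iff.2 (by
    have : 0 ≤ s / 4 * x := by positivity
    linarith)
  have hexp : Real.exp (s / 2 * x) * Real.exp (s / 2 * x) = Real.exp (s * x) := by
    rw [← Real.exp_add]; congr 1; ring
  rw [hsplit]
  refine (abs_add_le _ _).trans ?_
  rw [abs_mul, abs_mul, abs_of_pos (Real.exp_pos _)]
  have h2 : |T.eval x - Real.exp (-(s / 4 * x))| * |q.eval x| ≤
      ε / (2 * (D + 1)) * Real.exp (s / 2 * x) * ((D + 1) * Real.exp (s / 2 * x)) := by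
    refine mul_le_mul (hT x hx) ((hqD x hx).trans ?_) (abs_nonneg _) (by positivity)
    exact mul_le_mul_of_nonneg_right (by linarith) (Real.exp_pos _).le
  have h3 : Real.exp (-(s / 4 * x)) * |q.eval x - g x| ≤ ε / 2 * Real.exp (s * x) :=
    (mul_le_of_le_one_left (abs_nonneg _) h1).trans (hq x hx)
  have h4 : ε / (2 * (D + 1)) * Real.exp (s / 2 * x) * ((D + 1) * Real.exp (s / 2 * x)) =
      ε / 2 * Real.exp (s * x) := by
    rw [← hexp]; field_simp
  linarith

theorem polyApprox_eval_exp {s : ℝ} (hs : 0 < s) (P : ℝ[X]) :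
    PolyApprox s (fun x => P.eval (Real.exp (-(s / 4 * x)))) := by
  have hpow : ∀ k : ℕ, PolyApprox s (fun x => Real.exp (-(s / 4 * x)) ^ k) := by
    intro k
    induction k with
    | zero =>
      refine fun ε hε => ⟨1, fun x _ => ?_⟩
      simp only [eval_one, pow_zero, sub_self, abs_zero]
      positivity
    | succ k ih =>
      simp only [pow_succ']
      exact ih.exp_mul hs
  induction P using Polynomial.induction_on' with
  | add p q hp hq => simpa only [eval_add] using hp.add hq
  | monomial n a => simpa only [eval_monomial] using (hpow n).const_mul a

/-- Continuous functions vanishing near infinity are approximable: in the variable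
`y = exp (-s x / 4)` this is the Weierstrass theorem on `[0, 1]`. -/
theorem polyApprox_of_eq_zero {s : ℝ} (hs : 0 < s) {g : ℝ → ℝ} (hg : Continuous g) {R : ℝ}
    (hR : ∀ x, R ≤ x → g x = 0) : PolyApprox s g := fun ε hε => by
  -- clamping the argument at `exp (-s R / 4)` makes the transformed function continuous at `0`
  set h : ℝ → ℝ := fun y => g (-Real.log (max y (Real.exp (-(s / 4 * R)))) / (s / 4)) with hh
  have hpos : ∀ y, 0 < max y (Real.exp (-(s / 4 * R))) := fun y =>
    lt_max_of_lt_right (Real.exp_pos _)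
  have hcont : Continuous h := hg.comp (((continuous_id.max continuous_const).log
    fun y => (hpos y).ne').neg.div_const _)
  have hval : ∀ x, h (Real.exp (-(s / 4 * x))) = g x := by
    intro x
    have h4 : (0 : ℝ) < s / 4 := by positivity
    rw [hh]
    rcases le_total x R with hx | hx
    · have : Real.exp (-(s / 4 * R)) ≤ Real.exp (-(s / 4 * x)) :=
        Real.exp_le_exp.2 (neg_le_neg (mul_le_mul_of_nonneg_left hx h4.le))
      simp only [max_eq_left this, Real.log_exp, neg_neg]
      rw [mul_div_cancel_left₀ _ h4.ne']
    · have : Real.exp (-(s / 4 * x)) ≤ Real.exp (-(s / 4 * R)) :=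
        Real.exp_le_exp.2 (neg_le_neg (mul_le_mul_of_nonneg_left hx h4.le))
      simp only [max_eq_right this, Real.log_exp, neg_neg]
      rw [mul_div_cancel_left₀ _ h4.ne', hR x hx, hR R le_rfl]
  obtain ⟨P, hP⟩ := exists_polynomial_near_of_continuousOn 0 1 h hcont.continuousOn (ε / 2)
    (half_pos hε)
  obtain ⟨q, hq⟩ := polyApprox_eval_exp hs P (ε / 2) (half_pos hε)
  refine ⟨q, fun x hx => ?_⟩
  have hsx : 0 ≤ s * x := by positivity
  have h1 := hP (Real.exp (-(s / 4 * x))) ⟨(Real.exp_pos _).le, Real.exp_le_one_iff.2 (by linarith)⟩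
  rw [hval] at h1
  have h2 := hq x hx
  have h3 : 1 ≤ Real.exp (s * x) := Real.one_le_exp hsx
  have h4 := abs_sub_le (q.eval x) (P.eval (Real.exp (-(s / 4 * x)))) (g x)
  nlinarith

theorem exists_antiderivative (q : ℝ[X]) (c : ℝ) :
    ∃ p : ℝ[X], derivative p = q ∧ p.eval 0 = c := by
  have h : ∃ p : ℝ[X], derivative p = q := by
    induction q using Polynomial.induction_on' with
    | add p q hp hq =>
      obtain ⟨a, rfl⟩ := hp
      obtain ⟨b, rfl⟩ := hq
      exact ⟨a + b, derivative_add⟩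
    | monomial n a =>
      refine ⟨monomial (n + 1) (a / (n + 1)), ?_⟩
      rw [derivative_monomial]
      congr 1
      push_cast
      field_simp
  obtain ⟨p, rfl⟩ := h
  exact ⟨p + C (c - p.eval 0), by simp, by simp⟩

end WeightedApproximation

/-! ### Linear statistics and the variance -/

namespace LaguerreEnsemble

open MeasureTheory Filter Topology LaguerreAlgebra

variable {N : ℕ} {M β : ℝ}

/-- The polynomial `N⁻¹ ∑ u(x_i)` in the particles. -/
noncomputable def linearStatistic (N : ℕ) (u : Polynomial ℝ) : MvPolynomial (Fin N) ℝ :=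
  MvPolynomial.C (N : ℝ)⁻¹ * ∑ i, Polynomial.aeval (MvPolynomial.X i) u

theorem eval_aeval_X (u : Polynomial ℝ) (i : Fin N) (x : Fin N → ℝ) :
    MvPolynomial.eval x (Polynomial.aeval (MvPolynomial.X i) u) = u.eval (x i) := by
  rw [← MvPolynomial.coe_aeval_eq_eval, RingHom.coe_coe, ← Polynomial.aeval_algHom_apply,
    MvPolynomial.aeval_X, Polynomial.coe_aeval_eq_eval]

theorem eval_linearStatistic (u : Polynomial ℝ) (x : Fin N → ℝ) :
    MvPolynomial.eval x (linearStatistic N u) = (N : ℝ)⁻¹ * ∑ i, u.eval (x i) := by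
  simp [linearStatistic, eval_aeval_X]

theorem isSymmetric_linearStatistic (u : Polynomial ℝ) : (linearStatistic N u).IsSymmetric := by
  intro e
  rw [linearStatistic, map_mul, MvPolynomial.rename_C, map_sum]
  congr 1
  have : ∀ i, MvPolynomial.rename e (Polynomial.aeval (MvPolynomial.X i) u) =
      Polynomial.aeval (MvPolynomial.X (e i) : MvPolynomial (Fin N) ℝ) u := fun i => by
    rw [← Polynomial.aeval_algHom_apply, MvPolynomial.rename_X]
  simp only [this]
  exact Equiv.sum_comp e fun i => Polynomial.aeval (MvPolynomial.X i : MvPolynomial (Fin N) ℝ) u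

theorem eval_pderiv_linearStatistic (u : Polynomial ℝ) (i : Fin N) (x : Fin N → ℝ) :
    MvPolynomial.eval x (MvPolynomial.pderiv i (linearStatistic N u)) =
      (N : ℝ)⁻¹ * u.derivative.eval (x i) := by
  rw [linearStatistic, MvPolynomial.pderiv_C_mul, map_mul, MvPolynomial.eval_C, map_sum]
  congr 1
  rw [Finset.sum_eq_single i]
  · rw [Derivation.map_aeval, MvPolynomial.pderiv_X_self, smul_eq_mul, mul_one, eval_aeval_X]
  · intro j _ hj
    rw [Derivation.map_aeval, MvPolynomial.pderiv_X_of_ne hj, smul_zero]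
  · simp

/-- The Poincaré inequality for polynomial linear statistics. -/
theorem variance_linearStatistic_le (hN : 1 ≤ N) (hβ : 0 < β) (hM : (N : ℝ) - 1 < M)
    (u : Polynomial ℝ) :
    2 * (expect M β (linearStatistic N u * linearStatistic N u) -
      expect M β (linearStatistic N u) ^ 2) ≤
    4 / (β * M * N) * ∫ x, (N : ℝ)⁻¹ * ∑ i, x i * u.derivative.eval (x i) ^ 2
      ∂(betaLaguerre N M β) := by
  have hb := rate_pos hN hβ hM
  have hN0 : (0 : ℝ) < N := by exact_mod_cast hN
  have h := poincare_of_mem_symmDegreeLE hN hβ hM _ (linearStatistic N u)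
    (mem_symmDegreeLE.2 ⟨isSymmetric_linearStatistic u, le_rfl⟩)
  have hΓ : expect M β (carreDuChamp (linearStatistic N u) (linearStatistic N u)) =
      (N : ℝ)⁻¹ * ∫ x, (N : ℝ)⁻¹ * ∑ i, x i * u.derivative.eval (x i) ^ 2
        ∂(betaLaguerre N M β) := by
    rw [expect, ← integral_const_mul]
    congr 1
    ext x
    simp only [carreDuChamp, map_sum, map_mul, MvPolynomial.eval_X, eval_pderiv_linearStatistic,
      Finset.mul_sum]
    exact Finset.sum_congr rfl fun i _ => by ring
  rw [hΓ] at h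
  set V := expect M β (linearStatistic N u * linearStatistic N u) -
      expect M β (linearStatistic N u) ^ 2
  set I := ∫ x, (N : ℝ)⁻¹ * ∑ i, x i * u.derivative.eval (x i) ^ 2 ∂(betaLaguerre N M β)
  have hβM : 0 < β * M := by linarith
  rw [div_mul_eq_mul_div, le_div_iff₀ (by positivity)]
  have h2 := mul_le_mul_of_nonneg_left h (by positivity : (0 : ℝ) ≤ 4 * N)
  have h3 : 4 * (N : ℝ) * ((N : ℝ)⁻¹ * I) = 4 * I := by field_simp
  rw [h3] at h2
  linarith

theorem ofReal_expect (hN : 1 ≤ N) (hβ : 0 < β) (hM : (N : ℝ) - 1 < M)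
    {p : MvPolynomial (Fin N) ℝ} (hp : ∀ x, 0 ≤ MvPolynomial.eval x p) :
    ENNReal.ofReal (expect M β p) =
      ∫⁻ x, ENNReal.ofReal (MvPolynomial.eval x p) ∂(betaLaguerre N M β) :=
  ofReal_integral_eq_lintegral_ofReal (integrable_eval hN hβ hM _) (Eventually.of_forall hp)

theorem lintegral_sq_sub_const (hN : 1 ≤ N) (hβ : 0 < β) (hM : (N : ℝ) - 1 < M)
    (p : MvPolynomial (Fin N) ℝ) (c : ℝ) :
    ∫⁻ x, ENNReal.ofReal ((MvPolynomial.eval x p - c) ^ 2) ∂(betaLaguerre N M β) =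
      ENNReal.ofReal (expect M β (p * p) - 2 * c * expect M β p + c ^ 2) := by
  have h1 : p * p + (MvPolynomial.C (-(2 * c)) * p + MvPolynomial.C (c ^ 2)) =
      (p - MvPolynomial.C c) ^ 2 := by
    rw [MvPolynomial.C_neg, MvPolynomial.C_mul, MvPolynomial.C_pow,
      show (MvPolynomial.C 2 : MvPolynomial (Fin N) ℝ) = 2 from map_ofNat MvPolynomial.C 2]
    ring
  have h2 : expect M β (p * p) - 2 * c * expect M β p + c ^ 2 =
      expect M β ((p - MvPolynomial.C c) ^ 2) := by
    rw [← h1, expect_add hN hβ hM, expect_add hN hβ hM, expect_C_mul, expect_C hN hβ hM]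
    ring
  rw [h2, ofReal_expect hN hβ hM fun x => by rw [map_pow]; positivity]
  simp

/-- The variance as half the mean square difference of two independent copies. -/
theorem lintegral_lintegral_sq_sub (hN : 1 ≤ N) (hβ : 0 < β) (hM : (N : ℝ) - 1 < M)
    (p : MvPolynomial (Fin N) ℝ) :
    ∫⁻ y, ∫⁻ x, ENNReal.ofReal ((MvPolynomial.eval x p - MvPolynomial.eval y p) ^ 2)
      ∂(betaLaguerre N M β) ∂(betaLaguerre N M β) =
      ENNReal.ofReal (2 * (expect M β (p * p) - expect M β p ^ 2)) := by
  simp only [lintegral_sq_sub_const hN hβ hM]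
  have h0 : ∀ c : ℝ, 0 ≤ expect M β (p * p) - 2 * c * expect M β p + c ^ 2 := fun c => by
    have h1 := expect_sq_nonneg (M := M) (β := β) (p - MvPolynomial.C c)
    have h2 : (p - MvPolynomial.C c) * (p - MvPolynomial.C c) =
        p * p + (MvPolynomial.C (-(2 * c)) * p + MvPolynomial.C (c ^ 2)) := by
      rw [MvPolynomial.C_neg, MvPolynomial.C_mul, MvPolynomial.C_pow,
        show (MvPolynomial.C 2 : MvPolynomial (Fin N) ℝ) = 2 from map_ofNat MvPolynomial.C 2]
      ring
    rw [h2, expect_add hN hβ hM, expect_add hN hβ hM, expect_C_mul, expect_C hN hβ hM] at h1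
    linarith
  have h3 : ∀ y : Fin N → ℝ, expect M β (p * p) - 2 * MvPolynomial.eval y p * expect M β p +
      MvPolynomial.eval y p ^ 2 = MvPolynomial.eval y (MvPolynomial.C (expect M β (p * p)) +
        (MvPolynomial.C (-(2 * expect M β p)) * p + p * p)) := fun y => by
    simp only [map_add, map_mul, MvPolynomial.eval_C]; ring
  rw [show 2 * (expect M β (p * p) - expect M β p ^ 2) =
    expect M β (MvPolynomial.C (expect M β (p * p)) +
        (MvPolynomial.C (-(2 * expect M β p)) * p + p * p)) by
      rw [expect_add hN hβ hM, expect_add hN hβ hM, expect_C_mul, expect_C hN hβ hM]; ring]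
  rw [ofReal_expect hN hβ hM fun y => by rw [← h3]; exact h0 _]
  simp only [h3]

end LaguerreEnsemble

/-- The extended variance is at most the mean square deviation from any constant, also when the
function is not square integrable. -/
theorem ProbabilityTheory.evariance_le_lintegral_sq_sub {Ω : Type*} [MeasurableSpace Ω]
    {μ : MeasureTheory.Measure Ω} [MeasureTheory.IsProbabilityMeasure μ] {F : Ω → ℝ}
    (hF : Measurable F) (c : ℝ) :
    evariance F μ ≤ ∫⁻ x, ENNReal.ofReal ((F x - c) ^ 2) ∂μ := by
  by_cases htop : ∫⁻ x, ENNReal.ofReal ((F x - c) ^ 2) ∂μ = ∞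
  · rw [htop]; exact le_top
  have hm : MeasureTheory.AEStronglyMeasurable (fun x => F x - c) μ :=
    (hF.sub_const c).aestronglyMeasurable
  have hint : MeasureTheory.Integrable (fun x => (F x - c) ^ 2) μ := by
    refine ⟨hm.pow 2, ?_⟩
    rw [MeasureTheory.hasFiniteIntegral_iff_ofReal
      (Filter.Eventually.of_forall fun x => sq_nonneg _)]
    exact lt_top_iff_ne_top.2 htop
  have hL : MeasureTheory.MemLp (fun x => F x - c) 2 μ :=
    (MeasureTheory.memLp_two_iff_integrable_sq hm).2 hint
  have hFL : MeasureTheory.MemLp F 2 μ := by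
    simpa [Pi.add_def] using hL.add (MeasureTheory.memLp_const c)
  rw [← ofReal_variance hFL, ← MeasureTheory.ofReal_integral_eq_lintegral_ofReal hint
    (Filter.Eventually.of_forall fun x => sq_nonneg _)]
  refine ENNReal.ofReal_le_ofReal ?_
  rw [← variance_sub_const hF.aestronglyMeasurable c]
  exact variance_le_expectation_sq hm

/-! ### Passage to continuously differentiable functions -/

namespace LaguerreEnsemble

open MeasureTheory Filter Topology LaguerreAlgebra

variable {N : ℕ} {M β : ℝ}

theorem ae_mem_posOrthant_betaLaguerre : ∀ᵐ x ∂(betaLaguerre N M β), x ∈ posOrthant N :=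
  Measure.smul_absolutelyContinuous.ae_le ae_mem_posOrthant

/-- Polynomials `u` whose values approximate `f` and whose derivatives approximate `f'`, on the
half-line and with an exponential weight. -/
theorem exists_polynomial_sequence {f : ℝ → ℝ} (hf : ContDiff ℝ 1 f) {s : ℝ} (hs : 0 < s) :
    ∃ u : ℕ → Polynomial ℝ,
      (∀ n x, 0 ≤ x → |(u n).derivative.eval x| ≤ |deriv f x| + Real.exp (s * x)) ∧
      (∀ x, 0 ≤ x → Tendsto (fun n => (u n).derivative.eval x) atTop (𝓝 (deriv f x))) ∧
      (∀ x, 0 ≤ x → Tendsto (fun n => (u n).eval x) atTop (𝓝 (f x))) := by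
  have hf' : Continuous (deriv f) := hf.continuous_deriv le_rfl
  have hdf : Differentiable ℝ f := hf.differentiable one_ne_zero
  set θ : ℕ → ℝ → ℝ := fun n x => max 0 (min 1 (n + 1 - x)) with hθ
  have hθc : ∀ n, Continuous (θ n) := fun n =>
    continuous_const.max (continuous_const.min (continuous_const.sub continuous_id))
  have hθ0 : ∀ n x, 0 ≤ θ n x := fun n x => le_max_left _ _
  have hθ1 : ∀ n x, θ n x ≤ 1 := fun n x => max_le zero_le_one (min_le_left _ _)
  have hθn : ∀ (n : ℕ) (x : ℝ), x ≤ n → θ n x = 1 := fun n x hx => by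
    simp only [hθ]
    rw [min_eq_left (by linarith), max_eq_right zero_le_one]
  have happ : ∀ n : ℕ, ∃ u : Polynomial ℝ, u.eval 0 = f 0 ∧ ∀ x, 0 ≤ x →
      |u.derivative.eval x - θ n x * deriv f x| ≤ 1 / ((n : ℝ) + 1) * Real.exp (s * x) := by
    intro n
    obtain ⟨q, hq⟩ := WeightedApproximation.polyApprox_of_eq_zero hs ((hθc n).mul hf')
      (R := n + 1) (fun x hx => by
        simp only [hθ, Pi.mul_apply]
        rw [max_eq_left ((min_le_right _ _).trans (by linarith)), zero_mul])
      (1 / ((n : ℝ) + 1)) (by positivity)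
    obtain ⟨p, rfl, hp⟩ := WeightedApproximation.exists_antiderivative q (f 0)
    exact ⟨p, hp, hq⟩
  choose u hu0 hu using happ
  have hle : ∀ n : ℕ, 1 / ((n : ℝ) + 1) ≤ 1 := fun n => by
    rw [div_le_one (by positivity)]
    have : (0 : ℝ) ≤ n := n.cast_nonneg
    linarith
  have hlim : ∀ c : ℝ, Tendsto (fun n : ℕ => 1 / ((n : ℝ) + 1) * c) atTop (𝓝 0) := fun c => by
    simpa using tendsto_one_div_add_atTop_nhds_zero_nat.mul_const c
  refine ⟨u, fun n x hx => ?_, fun x hx => ?_, fun x hx => ?_⟩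
  · have h1 := abs_sub_abs_le_abs_sub ((u n).derivative.eval x) (θ n x * deriv f x)
    have h2 : |θ n x * deriv f x| ≤ |deriv f x| := by
      rw [abs_mul, abs_of_nonneg (hθ0 n x)]
      exact mul_le_of_le_one_left (abs_nonneg _) (hθ1 n x)
    have h3 : 1 / ((n : ℝ) + 1) * Real.exp (s * x) ≤ Real.exp (s * x) :=
      mul_le_of_le_one_left (Real.exp_pos _).le (hle n)
    linarith [hu n x hx]
  · rw [tendsto_iff_norm_sub_tendsto_zero]
    refine squeeze_zero' (Eventually.of_forall fun n => norm_nonneg _) ?_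
      (hlim (Real.exp (s * x)))
    filter_upwards [eventually_ge_atTop ⌈x⌉₊] with n hn
    have := hu n x hx
    rwa [hθn n x (Nat.ceil_le.1 hn), one_mul] at this
  · rw [tendsto_iff_norm_sub_tendsto_zero]
    refine squeeze_zero' (Eventually.of_forall fun n => norm_nonneg _) ?_
      (hlim (Real.exp (s * x) * x))
    filter_upwards [eventually_ge_atTop ⌈x⌉₊] with n hn
    have hd : ∀ y ∈ Set.Icc 0 x, HasDerivWithinAt (fun y => (u n).eval y - f y)
        ((u n).derivative.eval y - deriv f y) (Set.Icc 0 x) y := fun y _ =>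
      (((u n).hasDerivAt y).sub (hdf y).hasDerivAt).hasDerivWithinAt
    have h1 := norm_image_sub_le_of_norm_deriv_le_segment' hd
      (C := 1 / ((n : ℝ) + 1) * Real.exp (s * x)) (fun y hy => by
        have h2 := hu n y hy.1
        rw [hθn n y (hy.2.le.trans (Nat.ceil_le.1 hn)), one_mul] at h2
        refine h2.trans (mul_le_mul_of_nonneg_left (Real.exp_le_exp.2 ?_) (by positivity))
        exact mul_le_mul_of_nonneg_left hy.2.le hs.le) x ⟨hx, le_rfl⟩
    rw [hu0 n, sub_self, sub_zero, sub_zero, mul_assoc] at h1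
    exact h1

theorem integral_empiricalLaw (f : ℝ → ℝ) (x : Fin N → ℝ) :
    ∫ t, f t ∂(empiricalLaw x) = (N : ℝ)⁻¹ * ∑ i, f (x i) := by
  rw [empiricalLaw, integral_smul_measure, integral_finsetSum_measure fun i _ =>
    integrable_dirac (by simp)]
  simp

theorem lintegral_empiricalLaw (g : ℝ → ℝ≥0∞) (x : Fin N → ℝ) :
    ∫⁻ t, g t ∂(empiricalLaw x) = (N : ℝ≥0∞)⁻¹ * ∑ i, g (x i) := by
  rw [empiricalLaw, lintegral_smul_measure, lintegral_finsetSum_measure]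
  simp

theorem lintegral_empiricalLaw_ofReal (hN : 1 ≤ N) (g : ℝ → ℝ) {x : Fin N → ℝ}
    (hx : x ∈ posOrthant N) :
    ∫⁻ t, ENNReal.ofReal (t * g t ^ 2) ∂(empiricalLaw x) =
      ENNReal.ofReal ((N : ℝ)⁻¹ * ∑ i, x i * g (x i) ^ 2) := by
  have hN0 : (0 : ℝ) < N := by exact_mod_cast hN
  rw [lintegral_empiricalLaw, ENNReal.ofReal_mul (by positivity), ENNReal.ofReal_inv_of_pos hN0,
    ENNReal.ofReal_natCast, ENNReal.ofReal_sum_of_nonneg fun i _ =>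
      mul_nonneg (hx i).le (sq_nonneg _)]

/-- The Dirichlet energies of the approximating polynomials converge. -/
theorem tendsto_lintegral_energy (hN : 1 ≤ N) (hβ : 0 < β) (hM : (N : ℝ) - 1 < M) {g : ℝ → ℝ}
    (hg : Continuous g) {q : ℕ → Polynomial ℝ}
    (hq : ∀ n x, 0 ≤ x → |(q n).eval x| ≤ |g x| + Real.exp (β * M / 8 * x))
    (hlim : ∀ x, 0 ≤ x → Tendsto (fun n => (q n).eval x) atTop (𝓝 (g x)))
    (hfin : ∫⁻ x, ENNReal.ofReal ((N : ℝ)⁻¹ * ∑ i, x i * g (x i) ^ 2)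
      ∂(betaLaguerre N M β) ≠ ∞) :
    Tendsto (fun n => ∫⁻ x, ENNReal.ofReal ((N : ℝ)⁻¹ * ∑ i, x i * (q n).eval (x i) ^ 2)
      ∂(betaLaguerre N M β)) atTop
      (𝓝 (∫⁻ x, ENNReal.ofReal ((N : ℝ)⁻¹ * ∑ i, x i * g (x i) ^ 2) ∂(betaLaguerre N M β))) := by
  have hb := rate_pos hN hβ hM
  have hN0 : (0 : ℝ) ≤ (N : ℝ)⁻¹ := by positivity
  have meas : ∀ h : ℝ → ℝ, Continuous h →
      Measurable fun x : Fin N → ℝ => (N : ℝ)⁻¹ * ∑ i, x i * h (x i) ^ 2 := fun h hh => by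
    refine Continuous.measurable ?_
    fun_prop
  have hE : Integrable (fun x : Fin N → ℝ =>
      (N : ℝ)⁻¹ * ∑ i, x i * Real.exp (β * M / 8 * x i) ^ 2) (betaLaguerre N M β) := by
    obtain ⟨C, hC, hb2⟩ := Subexponential.sum_coord (N := N) (β * M / 16) (by linarith)
    refine Integrable.smul_measure ?_ (ENNReal.inv_ne_top.2 laguerreZ_ne_zero)
    have hmE := meas (fun t => Real.exp (β * M / 8 * t)) (by fun_prop)
    refine integrable_of_abs_le_exp hβ hM hmE (C := (N : ℝ)⁻¹ * C)
      (t := β * M / 16 + β * M / 4) (by linarith) fun x hx => ?_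
    have hx0 : 0 ≤ ∑ i, x i := sum_nonneg_of_mem_posOrthant hx
    have h1 : ∑ i, x i * Real.exp (β * M / 8 * x i) ^ 2 ≤
        (∑ i, x i) * Real.exp (β * M / 4 * ∑ i, x i) := by
      rw [Finset.sum_mul]
      refine Finset.sum_le_sum fun i _ => mul_le_mul_of_nonneg_left ?_ (hx i).le
      rw [← Real.exp_nat_mul]
      refine Real.exp_le_exp.2 ?_
      have : x i ≤ ∑ i, x i :=
        Finset.single_le_sum (f := x) (fun j _ => (hx j).le) (Finset.mem_univ i)
      push_cast
      nlinarith
    have h2 : 0 ≤ ∑ i, x i * Real.exp (β * M / 8 * x i) ^ 2 :=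
      Finset.sum_nonneg fun i _ => mul_nonneg (hx i).le (sq_nonneg _)
    rw [abs_of_nonneg (mul_nonneg hN0 h2), mul_assoc]
    refine mul_le_mul_of_nonneg_left (h1.trans ?_) hN0
    rw [add_mul, Real.exp_add, ← mul_assoc]
    exact mul_le_mul_of_nonneg_right ((le_abs_self _).trans (hb2 x hx)) (Real.exp_pos _).le
  refine tendsto_lintegral_of_dominated_convergence
    (fun x => 2 * ENNReal.ofReal ((N : ℝ)⁻¹ * ∑ i, x i * g (x i) ^ 2) +
      2 * ENNReal.ofReal ((N : ℝ)⁻¹ * ∑ i, x i * Real.exp (β * M / 8 * x i) ^ 2))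
    (fun n => (meas _ (q n).continuous).ennreal_ofReal) (fun n => ?_) ?_ ?_
  · filter_upwards [ae_mem_posOrthant_betaLaguerre] with x hx
    have h2 : ∀ h : ℝ → ℝ, 0 ≤ (N : ℝ)⁻¹ * ∑ i, x i * h (x i) ^ 2 := fun h =>
      mul_nonneg hN0 (Finset.sum_nonneg fun i _ => mul_nonneg (hx i).le (sq_nonneg _))
    rw [← mul_add, ← ENNReal.ofReal_add (h2 g) (h2 fun y => Real.exp (β * M / 8 * y)),
      show (2 : ℝ≥0∞) = ENNReal.ofReal 2 by simp, ← ENNReal.ofReal_mul zero_le_two]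
    refine ENNReal.ofReal_le_ofReal ?_
    rw [← mul_add, ← Finset.sum_add_distrib, mul_left_comm]
    refine mul_le_mul_of_nonneg_left ?_ hN0
    rw [Finset.mul_sum]
    refine Finset.sum_le_sum fun i _ => ?_
    rw [← mul_add, mul_left_comm]
    refine mul_le_mul_of_nonneg_left ?_ (hx i).le
    have h3 := hq n (x i) (hx i).le
    have h4 : (q n).eval (x i) ^ 2 ≤ (|g (x i)| + Real.exp (β * M / 8 * x i)) ^ 2 := by
      rw [← sq_abs ((q n).eval (x i))]
      exact pow_le_pow_left₀ (abs_nonneg _) h3 2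
    have h5 := sq_nonneg (|g (x i)| - Real.exp (β * M / 8 * x i))
    rw [← sq_abs (g (x i))]
    nlinarith
  · rw [lintegral_add_left ((meas g hg).ennreal_ofReal.const_mul 2),
      lintegral_const_mul _ (meas g hg).ennreal_ofReal,
      lintegral_const_mul _
        (meas (fun t => Real.exp (β * M / 8 * t)) (by fun_prop)).ennreal_ofReal]
    refine ENNReal.add_ne_top.2 ⟨ENNReal.mul_ne_top (by simp) hfin,
      ENNReal.mul_ne_top (by simp) ?_⟩
    exact hE.lintegral_lt_top.ne
  · filter_upwards [ae_mem_posOrthant_betaLaguerre] with x hx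
    refine (ENNReal.continuous_ofReal.tendsto _).comp (Tendsto.const_mul _ ?_)
    exact tendsto_finsetSum _ fun i _ => ((hlim (x i) (hx i).le).pow 2).const_mul _

/-- The Poincaré inequality passes to the limit along pointwise convergent linear statistics, by
Fatou's lemma applied to the differences of two independent copies. -/
theorem evariance_le_of_tendsto (hN : 1 ≤ N) (hβ : 0 < β) (hM : (N : ℝ) - 1 < M) {f : ℝ → ℝ}
    (hf : Continuous f) {u : ℕ → Polynomial ℝ}
    (hlim : ∀ x, 0 ≤ x → Tendsto (fun n => (u n).eval x) atTop (𝓝 (f x))) {B : ℝ≥0∞}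
    (hB : Tendsto (fun n => ∫⁻ x, ENNReal.ofReal
      ((N : ℝ)⁻¹ * ∑ i, x i * (u n).derivative.eval (x i) ^ 2) ∂(betaLaguerre N M β)) atTop (𝓝 B)) :
    ProbabilityTheory.evariance (fun x : Fin N → ℝ => (N : ℝ)⁻¹ * ∑ i, f (x i))
      (betaLaguerre N M β) ≤ ENNReal.ofReal (4 / (β * M * N)) * B := by
  have := isProbabilityMeasure_betaLaguerre hN hβ hM
  have hb := rate_pos hN hβ hM
  have hβM : 0 < β * M := by linarith
  set μ := betaLaguerre N M β with hμ
  set F : (Fin N → ℝ) → ℝ := fun x => (N : ℝ)⁻¹ * ∑ i, f (x i) with hF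
  have hFm : Measurable F := by
    refine Continuous.measurable ?_
    fun_prop
  set p : ℕ → MvPolynomial (Fin N) ℝ := fun n => linearStatistic N (u n) with hp
  have hpF : ∀ x ∈ posOrthant N,
      Tendsto (fun n => MvPolynomial.eval x (p n)) atTop (𝓝 (F x)) := fun x hx => by
    simp only [hp, eval_linearStatistic]
    exact (tendsto_finsetSum _ fun i _ => hlim (x i) (hx i).le).const_mul _
  have hbound : ∀ n, ∫⁻ y, ∫⁻ x, ENNReal.ofReal
      ((MvPolynomial.eval x (p n) - MvPolynomial.eval y (p n)) ^ 2) ∂μ ∂μ ≤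
      ENNReal.ofReal (4 / (β * M * N)) * ∫⁻ x, ENNReal.ofReal
      ((N : ℝ)⁻¹ * ∑ i, x i * (u n).derivative.eval (x i) ^ 2) ∂μ := by
    intro n
    rw [lintegral_lintegral_sq_sub hN hβ hM]
    refine (ENNReal.ofReal_le_ofReal (variance_linearStatistic_le hN hβ hM (u n))).trans ?_
    rw [ENNReal.ofReal_mul (by positivity)]
    refine mul_le_mul_right ?_ _
    have hpoly : ∀ x : Fin N → ℝ, (N : ℝ)⁻¹ * ∑ i, x i * (u n).derivative.eval (x i) ^ 2 =
        MvPolynomial.eval x (MvPolynomial.C (N : ℝ)⁻¹ * ∑ i, MvPolynomial.X i *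
          Polynomial.aeval (MvPolynomial.X i) (u n).derivative ^ 2) := fun x => by
      simp [eval_aeval_X]
    refine le_of_eq (ofReal_integral_eq_lintegral_ofReal ?_ ?_)
    · simp only [hpoly]
      exact integrable_eval hN hβ hM _
    · filter_upwards [ae_mem_posOrthant_betaLaguerre] with x hx
      exact mul_nonneg (by positivity)
        (Finset.sum_nonneg fun i _ => mul_nonneg (hx i).le (sq_nonneg _))
  have hinner : ∀ y ∈ posOrthant N, ProbabilityTheory.evariance F μ ≤
      liminf (fun n => ∫⁻ x, ENNReal.ofReal
        ((MvPolynomial.eval x (p n) - MvPolynomial.eval y (p n)) ^ 2) ∂μ) atTop := by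
    intro y hy
    refine (ProbabilityTheory.evariance_le_lintegral_sq_sub hFm (F y)).trans ?_
    calc ∫⁻ x, ENNReal.ofReal ((F x - F y) ^ 2) ∂μ
        = ∫⁻ x, liminf (fun n => ENNReal.ofReal
            ((MvPolynomial.eval x (p n) - MvPolynomial.eval y (p n)) ^ 2)) atTop ∂μ := by
          refine lintegral_congr_ae ?_
          filter_upwards [ae_mem_posOrthant_betaLaguerre] with x hx
          refine (Tendsto.liminf_eq ?_).symm
          exact (ENNReal.continuous_ofReal.tendsto _).comp
            (((hpF x hx).sub (hpF y hy)).pow 2)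
      _ ≤ _ := lintegral_liminf_le fun n =>
          (((measurable_eval (p n)).sub_const _).pow_const 2).ennreal_ofReal
  calc ProbabilityTheory.evariance F μ = ∫⁻ _, ProbabilityTheory.evariance F μ ∂μ := by simp
    _ ≤ ∫⁻ y, liminf (fun n => ∫⁻ x, ENNReal.ofReal
        ((MvPolynomial.eval x (p n) - MvPolynomial.eval y (p n)) ^ 2) ∂μ) atTop ∂μ := by
        refine lintegral_mono_ae ?_
        filter_upwards [ae_mem_posOrthant_betaLaguerre] with y hy using hinner y hy
    _ ≤ liminf (fun n => ∫⁻ y, ∫⁻ x, ENNReal.ofReal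
        ((MvPolynomial.eval x (p n) - MvPolynomial.eval y (p n)) ^ 2) ∂μ ∂μ) atTop := by
        refine lintegral_liminf_le fun n => ?_
        simp only [hμ, lintegral_sq_sub_const hN hβ hM]
        have := measurable_eval (p n)
        fun_prop
    _ ≤ liminf (fun n => ENNReal.ofReal (4 / (β * M * N)) * ∫⁻ x, ENNReal.ofReal
      ((N : ℝ)⁻¹ * ∑ i, x i * (u n).derivative.eval (x i) ^ 2) ∂μ) atTop :=
        liminf_le_liminf (Eventually.of_forall hbound)
    _ = _ := (ENNReal.Tendsto.const_mul hB (Or.inr ENNReal.ofReal_ne_top)).liminf_eq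

end LaguerreEnsemble

open LaguerreEnsemble

/-- The law of the ensemble is a genuine probability measure, and the Poincaré inequality holds in
`[0, ∞]`: in particular, if the right-hand side is finite, then `⟨L_N, f⟩` is square integrable. -/
theorem theorem4 (N : ℕ) (hN : 1 ≤ N) (M β : ℝ) (hβ : 0 < β) (hM : (N : ℝ) - 1 < M)
    (f : ℝ → ℝ) (hf : ContDiff ℝ 1 f) :
    MeasureTheory.IsProbabilityMeasure (betaLaguerre N M β) ∧
    ProbabilityTheory.evariance (fun x : Fin N → ℝ => ∫ t, f t ∂(empiricalLaw x))
        (betaLaguerre N M β) ≤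
      ENNReal.ofReal (4 / (β * M * N)) *
        ∫⁻ x, (∫⁻ t, ENNReal.ofReal (t * (deriv f t) ^ 2) ∂(empiricalLaw x))
          ∂(betaLaguerre N M β) := by
  refine ⟨isProbabilityMeasure_betaLaguerre hN hβ hM, ?_⟩
  have hb := rate_pos hN hβ hM
  have hβM : 0 < β * M := by linarith
  have hN0 : (0 : ℝ) < N := by exact_mod_cast hN
  have hE : ∫⁻ x, (∫⁻ t, ENNReal.ofReal (t * (deriv f t) ^ 2) ∂(empiricalLaw x))
      ∂(betaLaguerre N M β) = ∫⁻ x, ENNReal.ofReal ((N : ℝ)⁻¹ * ∑ i, x i * deriv f (x i) ^ 2)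
        ∂(betaLaguerre N M β) := by
    refine MeasureTheory.lintegral_congr_ae ?_
    filter_upwards [ae_mem_posOrthant_betaLaguerre] with x hx
    exact lintegral_empiricalLaw_ofReal hN (deriv f) hx
  rw [hE]
  simp only [integral_empiricalLaw]
  by_cases hfin : ∫⁻ x, ENNReal.ofReal ((N : ℝ)⁻¹ * ∑ i, x i * deriv f (x i) ^ 2)
        ∂(betaLaguerre N M β) = ∞
  · rw [hfin, ENNReal.mul_top (ENNReal.ofReal_pos.2 (by positivity)).ne']
    exact le_top
  obtain ⟨u, h1, h2, h3⟩ := exists_polynomial_sequence hf (s := β * M / 8) (by positivity)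
  exact evariance_le_of_tendsto hN hβ hM hf.continuous h3
    (tendsto_lintegral_energy hN hβ hM (hf.continuous_deriv le_rfl) h1 h2 hfin)
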